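/- Let $L$ be a finite language with function symbols (including constants) only, let $\mathcal{V}$ be a variety of $L$-algebras, and let $\cdot$ be a binary term of $L$. For $A\in\mathcal{V}$ and $x,y\in A$ write $x\preceq y$ if $x\cdot y=x$. Suppose that 1. $\mathcal{V}$ is a variety of connected po-groupoids, that is, for every $A\in\mathcal{V}$ the relation $\preceq$ is a partial order on $A$ whose comparability graph is connected; 2. $\mathcal{V}$ is semidegenerate, that is, no nontrivial member of $\mathcal{V}$ has a one-element subalgebra; 3. $\mathcal{V}$ satisfies the identities $(x\cdot y)\cdot z\approx x\cdot(y\cdot z)$, $x\cdot x\approx x$ and $x\cdot y\cdot z\approx y\cdot x\cdot z$. Then the class of directly indecomposable algebras of $\mathcal{V}$ is axiomatizable by a $\Pi_4$ (i.e. $\forall\exists\forall\exists$) first-order sentence plus axioms for $\mathcal{V}$. That is, there is a prenex first-order sentence $\varphi$ of $L$ whose quantifier prefix has the form $\forall^*\exists^*\forall^*\exists^*$ (each block may be empty), such that the (nonempty) algebras satisfying $\varphi$ and the identities that define $\mathcal{V}$ are exactly the directly indecomposable members of $\mathcal{V}$. Here an algebra $A$ is directly indecomposable if it has more than one element and, whenever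 $A\cong B\times C$, one of $B$, $C$ has exactly one element. -/

import Mathlib

open scoped FirstOrder

universe u v w

namespace PoGroupoid

open FirstOrder FirstOrder.Language

section Hierarchy

variable {L : FirstOrder.Language.{u, v}} {α : Type*}

mutual

/-- The class `Π_k` of prenex formulas: `Π_0` consists of the quantifier-free formulas, and a
`Π_{k+1}` formula is a (possibly empty) block of universal quantifiers followed by a `Σ_k`
formula. -/
inductive IsPi : ℕ → ∀ {n : ℕ}, L.BoundedFormula α n → Prop
  | of_isQF {n : ℕ} {φ : L.BoundedFormula α n} (h : φ.IsQF) : IsPi 0 φ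
  | of_isSigma {k n : ℕ} {φ : L.BoundedFormula α n} (h : IsSigma k φ) : IsPi (k + 1) φ
  | all {k n : ℕ} {φ : L.BoundedFormula α (n + 1)} (h : IsPi (k + 1) φ) : IsPi (k + 1) φ.all

/-- The class `Σ_k` of prenex formulas: `Σ_0` consists of the quantifier-free formulas, and a
`Σ_{k+1}` formula is a (possibly empty) block of existential quantifiers followed by a `Π_k`
formula. -/
inductive IsSigma : ℕ → ∀ {n : ℕ}, L.BoundedFormula α n → Prop
  | of_isQF {n : ℕ} {φ : L.BoundedFormula α n} (h : φ.IsQF) : IsSigma 0 φ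
  | of_isPi {k n : ℕ} {φ : L.BoundedFormula α n} (h : IsPi k φ) : IsSigma (k + 1) φ
  | ex {k n : ℕ} {φ : L.BoundedFormula α (n + 1)} (h : IsSigma (k + 1) φ) : IsSigma (k + 1) φ.ex

end

end Hierarchy

/-- An identity `lhs ≈ rhs` between two terms in the variables `x_0, …, x_{arity - 1}`. -/
structure Identity (L : FirstOrder.Language.{u, v}) where
  /-- The number of variables. -/
  arity : ℕ
  /-- The left-hand side. -/
  lhs : L.Term (Fin arity)
  /-- The right-hand side. -/
  rhs : L.Term (Fin arity)

/-- The first-order sentence expressing an identity, i.e. its universal closure. -/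
def Identity.sentence {L : FirstOrder.Language.{u, v}} (e : Identity L) : L.Sentence :=
  (Term.bdEqual (e.lhs.relabel Sum.inr : L.Term (Empty ⊕ Fin e.arity))
    (e.rhs.relabel Sum.inr)).alls

/-- The first-order theory of a set of identities. The variety (equational class) defined by the
identities consists of the nonempty models of this theory. -/
def axiomsOf {L : FirstOrder.Language.{u, v}} (E : Set (Identity L)) : L.Theory :=
  Identity.sentence '' E

/-- The direct product of two structures. -/
instance prodStructure (L : FirstOrder.Language.{u, v}) (B C : Type*) [L.Structure B] [L.Structure C] :
    L.Structure (B × C) where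
  funMap f x := (Structure.funMap f fun i => (x i).1, Structure.funMap f fun i => (x i).2)
  RelMap r x := Structure.RelMap r (fun i => (x i).1) ∧ Structure.RelMap r fun i => (x i).2

/-- An algebra is directly indecomposable if it has more than one element and, whenever it is
isomorphic to a direct product of two algebras, one of these is trivial. -/
def DirectlyIndecomposable (L : FirstOrder.Language.{u, v}) (A : Type w) [L.Structure A] : Prop :=
  Nontrivial A ∧
    ∀ (B C : Type w) [L.Structure B] [L.Structure C],
      Nonempty (A ≃[L] (B × C)) → Subsingleton B ∨ Subsingleton C

/-- The variety defined by `E` is semidegenerate if no nontrivial member has a one-element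
subalgebra. -/
def Semidegenerate {L : FirstOrder.Language.{u, v}} (E : Set (Identity L)) : Prop :=
  ∀ (A : Type w) [L.Structure A], A ⊨ axiomsOf E → Nontrivial A →
    ∀ (S : L.Substructure A) (a : A), (S : Set A) ≠ {a}

section Operation

variable {L : FirstOrder.Language.{u, v}} (t : L.Term (Fin 2)) {A : Type w} [L.Structure A]

/-- The binary operation on an algebra given by a binary term. -/
def mul (x y : A) : A := t.realize ![x, y]

/-- The relation `x ⪯ y` given by `x · y = x`. -/
def rel (x y : A) : Prop := mul t x y = x

variable (A)

/-- The groupoid given by the binary term `t` is a po-groupoid. -/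
def IsPoGroupoid : Prop := IsPartialOrder A (rel t)

/-- The comparability graph of the relation `⪯` is connected. -/
def IsConnected : Prop := (SimpleGraph.fromRel (rel t : A → A → Prop)).Connected

/-- The groupoid given by `t` satisfies the identities `(x · y) · z ≈ x · (y · z)`, `x · x ≈ x`
and `x · y · z ≈ y · x · z` of relative semilattices. -/
def IsRelativeSemilattice : Prop :=
  (∀ x y z : A, mul t (mul t x y) z = mul t x (mul t y z)) ∧
  (∀ x : A, mul t x x = x) ∧
  (∀ x y z : A, mul t (mul t x y) z = mul t (mul t y x) z)

end Operation

end PoGroupoid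

/-!
An algebra `A` of the variety is decomposable if and only if it has a pair of nontrivial
complementary factor congruences, so the task is to define the two kernels of an arbitrary
decomposition `A ≅ B × C`, by a `Σ_2` formula that does not depend on `A`, from finitely many
parameters. To say that two `Σ_2` relations are nontrivial complementary factor congruences takes a
`Π_3` formula; hence decomposability is `Σ_4` and indecomposability is `Π_4`.

A decomposition is handled through the operation `f x y = (x_B, y_C)`. The kernel `θ` of the
projection to `B` transfers between opposite sides of squares: if `e` is the least upper bound of
`p` and `s`, and `q = p * s`, then `θ q p ↔ θ s e` (`RelSemilattice.IsMix.fst_square`). As being a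
least upper bound is `Π_1`, closing a `Σ_2` relation under the congruence rules and the square rule
once more gives a `Σ_2` relation again (`sigmaDef_stage`). The parameters are an element `w` and,
for finitely many pairs of unary terms `r_i`, `r'_i`, the two mixtures of `r_i(w)` and `r'_i(w)`;
let `Th` and `De` be the least congruences with the square property that relate `r_i(w)` and
`r'_i(w)` to their mixtures in the way the two kernels do.

The heart of the proof is that `Th` and `De` are the whole kernels
(`IsDecomposition.th_of_split`). Say that `x`, `y` split if `Th` and `De` relate them to their
mixtures. The pairs `r_i`, `r'_i` include `x` and `F(x, …, x)` for each basic operation `F`, so the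
class of `w` modulo the join of `Th` and `De` is a subalgebra, and by semidegeneracy the join is
total. They also include `p_k(x, x)` and `p_{k+1}(x, x)`, where the binary terms `p_k` form a path
from `x` to `y` in the comparability graph of the free algebra. A comparable pair that splits can
be moved along `De`, and along `Th`, to any other comparable pair
(`RelSemilattice.IsMix.split_of_le`). Moving from `w` to `z` shows that `p_k(z, z)` and
`p_{k+1}(z, z)` split for all `z`; moving then from `p_k(x, x)` to `p_k(x, y)` shows that elements
related by `Th` or `De`, and hence any two elements, are joined by a path of comparable pairs that
split. Such a path is cut into `Th`-steps and `De`-steps, which commute by the square rule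
(`RelSemilattice.IsMix.exchange`). So `Th` and `De` compose to the total relation, and being
contained in complementary congruences they are equal to them.

Each instance of `Th` is reached at a finite stage of the generation. An ultraproduct argument
(`exists_uniform_stage`) bounds the stage uniformly over the variety, and this gives the formula.
-/

/-! ### Squares in relative semilattices -/

namespace PoGroupoid

/-- A relative semilattice: an idempotent semigroup satisfying `x * y * z = y * x * z`. It is
ordered by `x ≤ y ↔ x * y = x`. -/
class RelSemilattice (M : Type*) extends Semigroup M where
  /-- Multiplication is idempotent. -/
  mul_self : ∀ x : M, x * x = x
  /-- Left factors commute. -/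
  mul_mul_comm : ∀ x y z : M, x * y * z = y * x * z

namespace RelSemilattice

variable {M B C : Type*} [RelSemilattice M] [RelSemilattice B] [RelSemilattice C]

theorem left_comm (x y z : M) : x * (y * z) = y * (x * z) := by
  rw [← mul_assoc, mul_mul_comm, mul_assoc]

theorem mul_eq_of_le {x y : M} (h : x * y = x) : y * x = x := by
  calc y * x = y * (x * y) := by rw [h]
    _ = x * (y * y) := left_comm _ _ _
    _ = x := by rw [mul_self, h]

theorem comm_of_le {x y z : M} (hx : x * z = x) (hy : y * z = y) : x * y = y * x := by
  calc x * y = x * (y * z) := by rw [hy]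
    _ = y * (x * z) := left_comm _ _ _
    _ = y * x := by rw [hx]

/-- `e` is the least upper bound of `p` and `s`, and `q = p * s` is their meet. In a direct
product the four vertices of every axis-parallel rectangle whose sides are comparable pairs
form such a square. -/
structure IsSquare (q p s e : M) : Prop where
  left_le : p * e = p
  right_le : s * e = s
  meet : p * s = q
  lub : ∀ v, p * v = p → s * v = s → e * v = e

theorem IsSquare.swap {q p s e : M} (h : IsSquare q p s e) : IsSquare q s p e :=
  ⟨h.right_le, h.left_le, by rw [← h.meet, comm_of_le h.left_le h.right_le],
    fun v hs hp => h.lub v hp hs⟩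

/-- A congruence of a relative semilattice which transfers between opposite sides of squares. -/
structure IsSquareCongruence (R : M → M → Prop) : Prop where
  equiv : Equivalence R
  mul : ∀ {x x' y y'}, R x x' → R y y' → R (x * y) (x' * y')
  square : ∀ {q p s e}, IsSquare q p s e → (R q p ↔ R s e)

/-- The map `f (x, y) = (x_B, y_C)` on a relative semilattice which is the direct product of its
images under the homomorphisms `a` and `b`. -/
structure IsMix (a : M → B) (b : M → C) (f : M → M → M) : Prop where
  fst_mul : ∀ x y, a (x * y) = a x * a y
  snd_mul : ∀ x y, b (x * y) = b x * b y
  fst_mix : ∀ x y, a (f x y) = a x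
  snd_mix : ∀ x y, b (f x y) = b y
  ext : ∀ {x y}, a x = a y → b x = b y → x = y

section Mix

variable {a : M → B} {b : M → C} {f : M → M → M}

theorem IsMix.flip (h : IsMix a b f) : IsMix b a fun x y => f y x :=
  ⟨h.snd_mul, h.fst_mul, fun x y => h.snd_mix y x, fun x y => h.fst_mix y x,
    fun h1 h2 => h.ext h2 h1⟩

theorem IsMix.le_iff (h : IsMix a b f) {x y : M} :
    x * y = x ↔ a x * a y = a x ∧ b x * b y = b x := by
  refine ⟨fun e => ⟨?_, ?_⟩, fun e => h.ext ?_ ?_⟩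
  · rw [← h.fst_mul, e]
  · rw [← h.snd_mul, e]
  · rw [h.fst_mul, e.1]
  · rw [h.snd_mul, e.2]

theorem IsMix.isSquare (h : IsMix a b f) {x y : M} (hxy : x * y = x) :
    IsSquare x (f y x) (f x y) y := by
  obtain ⟨h1, h2⟩ := h.le_iff.1 hxy
  refine ⟨?_, ?_, ?_, fun v hp hs => ?_⟩
  · rw [h.le_iff]; simp [h.fst_mix, h.snd_mix, mul_self, h2]
  · rw [h.le_iff]; simp [h.fst_mix, h.snd_mix, mul_self, h1]
  · apply h.ext
    · simp [h.fst_mul, h.fst_mix, mul_eq_of_le h1]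
    · simp [h.snd_mul, h.snd_mix, h2]
  · rw [h.le_iff] at *
    simp only [h.fst_mix, h.snd_mix] at hp hs
    exact ⟨hp.1, hs.2⟩

/-- The kernel of a projection transfers between opposite sides of squares: this is what makes
the square rule a sound way of generating factor congruences. -/
theorem IsMix.fst_square (h : IsMix a b f) {q p s e : M} (hsq : IsSquare q p s e) :
    a q = a p ↔ a s = a e := by
  have hp := h.le_iff.1 hsq.left_le
  have hs := h.le_iff.1 hsq.right_le
  constructor
  · intro hqp
    have hps : a p * a s = a p := by rw [← h.fst_mul, hsq.meet, hqp]
    have := h.le_iff.1 (hsq.lub (f s e) (by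
      rw [h.le_iff, h.fst_mix, h.snd_mix]; exact ⟨hps, hp.2⟩) (by
      rw [h.le_iff, h.fst_mix, h.snd_mix]; exact ⟨mul_self _, hs.2⟩))
    rw [h.fst_mix] at this
    rw [← this.1, mul_eq_of_le hs.1]
  · intro hse
    rw [← hsq.meet, h.fst_mul, hse, hp.1]

theorem IsMix.isSquareCongruence_fst (h : IsMix a b f) :
    IsSquareCongruence fun x y => a x = a y :=
  ⟨⟨fun _ => rfl, fun h => h.symm, fun h1 h2 => h1.trans h2⟩,
    fun h1 h2 => by simp only [h.fst_mul, h1, h2], h.fst_square⟩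

/-- The mixtures of `x` and `y` are related to `x` and `y` in the way that the projections
predict, not only modulo the kernels but modulo the subrelations `Th` and `De` of the kernels. -/
structure Split (f : M → M → M) (Th De : M → M → Prop) (x y : M) : Prop where
  th_left : Th x (f x y)
  de_right : De (f x y) y
  de_left : De x (f y x)
  th_right : Th (f y x) y

variable {Th De : M → M → Prop}

omit [RelSemilattice M] in
theorem Split.flip {x y : M} (h : Split f Th De x y) : Split (fun x y => f y x) De Th x y :=
  ⟨h.de_left, h.th_right, h.th_left, h.de_right⟩

theorem Split.symm (hTh : IsSquareCongruence Th) (hDe : IsSquareCongruence De) {x y : M}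
    (h : Split f Th De x y) : Split f Th De y x :=
  ⟨hTh.equiv.symm h.th_right, hDe.equiv.symm h.de_left, hDe.equiv.symm h.de_right,
    hTh.equiv.symm h.th_left⟩

/-- The key step. A comparable pair that splits can be moved along `De`: the corner
`y = f z' x'` satisfies `y * (f x z * z') = x * z'`, and this determines it modulo `De`. -/
theorem IsMix.split_of_le (h : IsMix a b f) (hTh : IsSquareCongruence Th)
    (hDe : IsSquareCongruence De) (hDe' : ∀ {x y}, De x y → b x = b y)
    {x z x' z' : M} (hxz : x * z = x) (hxz' : x' * z' = x') (hx : De x x') (hz : De z z')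
    (hs : Split f Th De x z) : Split f Th De x' z' := by
  obtain ⟨h1, h2⟩ := h.le_iff.1 hxz
  obtain ⟨h1', h2'⟩ := h.le_iff.1 hxz'
  have bx := hDe' hx
  have bz := hDe' hz
  have hy : f z' x' * z' = f z' x' := by
    rw [h.le_iff]; simp [h.fst_mix, h.snd_mix, mul_self, h2']
  have key : f x z * z' * f z' x' = x * z' := by
    apply h.ext
    · simp [h.fst_mul, h.fst_mix, mul_assoc, mul_self]
    · simp only [h.snd_mul, h.snd_mix, ← bx, ← bz, mul_self, h2, mul_eq_of_le h2]
  have hYz : De (f x z * z') z' := by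
    have := hDe.mul (hDe.equiv.trans hs.de_right hz) (hDe.equiv.refl z')
    rwa [mul_self] at this
  have hxy : De x' (f z' x') := by
    have e1 := hDe.mul hYz (hDe.equiv.refl (f z' x'))
    rw [key, mul_eq_of_le hy] at e1
    have e2 := hDe.mul hx (hDe.equiv.refl z')
    rw [hxz'] at e2
    exact hDe.equiv.trans (hDe.equiv.symm e2) e1
  have hsq : IsSquare (x * z') (f x z * z') (f z' x') z' := by
    refine ⟨by rw [mul_assoc, mul_self], hy, key, fun v hp hs => ?_⟩
    rw [h.le_iff] at hp hs ⊢
    simp only [h.fst_mul, h.snd_mul, h.fst_mix, h.snd_mix, ← bz, mul_self] at hp hs ⊢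
    exact ⟨hs.1, hp.2⟩
  have hyz : Th (f z' x') z' :=
    (hTh.square hsq).1 (hTh.mul hs.th_left (hTh.equiv.refl z'))
  have hsq' := h.isSquare hxz'
  exact ⟨(hTh.square hsq'.swap).2 hyz, (hDe.square hsq').1 hxy, hxy, hyz⟩

/-- The version of `IsMix.split_of_le` for two pairs that are comparable in the same order. -/
theorem IsMix.split_of_comparable (h : IsMix a b f) (hTh : IsSquareCongruence Th)
    (hDe : IsSquareCongruence De) (hDe' : ∀ {x y}, De x y → b x = b y)
    {x z x' z' : M} (hxz : x * z = x ∧ x' * z' = x' ∨ z * x = z ∧ z' * x' = z')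
    (hx : De x x') (hz : De z z')
    (hs : Split f Th De x z) : Split f Th De x' z' := by
  rcases hxz with hxz | hxz
  · exact h.split_of_le hTh hDe hDe' hxz.1 hxz.2 hx hz hs
  · exact (h.split_of_le hTh hDe hDe' hxz.1 hxz.2 hz hx (hs.symm hTh hDe)).symm hTh hDe

/-- Comparable elements. -/
def Comparable (x y : M) : Prop := x * y = x ∨ y * x = y

/-- A `De`-step followed by a `Th`-step can be exchanged for a `Th`-step followed by a
`De`-step, the four elements being the vertices of a rectangle. -/
theorem IsMix.exchange (h : IsMix a b f) (hTh : IsSquareCongruence Th)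
    (hDe : IsSquareCongruence De) (hTh' : ∀ {x y}, Th x y → a x = a y)
    (hDe' : ∀ {x y}, De x y → b x = b y) {x y z : M} (hxy : De x y) (hc : Comparable x y)
    (hyz : Th y z) (hc' : Comparable y z) :
    (Th x (f x z) ∧ Comparable x (f x z)) ∧ De (f x z) z ∧ Comparable (f x z) z := by
  have bxy := hDe' hxy
  have ayz := hTh' hyz
  have hcorner : f z x = y :=
    h.ext (by rw [h.fst_mix, ayz]) (by rw [h.snd_mix, bxy])
  have hcorner' : ∀ n, n = f x z → f n y = x ∧ f y n = z := by
    rintro n rfl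
    exact ⟨h.ext (by rw [h.fst_mix, h.fst_mix]) (by rw [h.snd_mix, bxy]),
      h.ext (by rw [h.fst_mix, ayz]) (by rw [h.snd_mix, h.snd_mix])⟩
  obtain ⟨g1, g2⟩ := hcorner' _ rfl
  have hle : ∀ {u v}, (a u * a v = a u ∧ b u * b v = b u) → u * v = u := fun h' => h.le_iff.2 h'
  have sTh : ∀ {u v}, Th u v → Th v u := hTh.equiv.symm
  have sDe : ∀ {u v}, De u v → De v u := hDe.equiv.symm
  rcases hc with hc | hc <;> rcases hc' with hc' | hc' <;>
    obtain ⟨p1, p2⟩ := h.le_iff.1 hc <;> obtain ⟨p3, p4⟩ := h.le_iff.1 hc'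
  · have sq := h.isSquare (hle ⟨by rw [← ayz, p1], by rw [bxy, p4]⟩ : x * z = x)
    rw [hcorner] at sq
    refine ⟨⟨(hTh.square sq.swap).2 hyz, Or.inl ?_⟩, (hDe.square sq).1 hxy, Or.inl sq.right_le⟩
    exact hle (by simp only [h.fst_mix, h.snd_mix, mul_self, bxy, p4, and_self])
  · have sq := h.isSquare (hle (by simp only [h.fst_mix, h.snd_mix, p1, p4, and_self]) :
      f x z * y = f x z)
    rw [g1, g2] at sq
    exact ⟨⟨sTh ((hTh.square sq.swap).2 (sTh hyz)),
      Or.inr (hle (by simp only [h.fst_mix, h.snd_mix, mul_self, bxy, p4, and_self]))⟩,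
      (hDe.square sq).2 hxy,
      Or.inl (hle (by simp only [h.fst_mix, h.snd_mix, mul_self, ← ayz, p1, and_self]))⟩
  · have sq := h.isSquare (hle (by simp only [h.fst_mix, h.snd_mix, p1, p4, and_self]) :
      y * f x z = y)
    rw [g1, g2] at sq
    exact ⟨⟨(hTh.square sq.swap).1 hyz, Or.inl sq.left_le⟩,
      sDe ((hDe.square sq).1 (sDe hxy)), Or.inr sq.right_le⟩
  · have sq := h.isSquare (hle ⟨by rw [← ayz, p1], by rw [bxy, p4]⟩ : z * x = z)
    rw [hcorner] at sq
    refine ⟨⟨sTh ((hTh.square sq.swap).1 (sTh hyz)), Or.inr sq.left_le⟩,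
      sDe ((hDe.square sq).2 (sDe hxy)), Or.inr ?_⟩
    exact hle (by simp only [h.fst_mix, h.snd_mix, mul_self, ← ayz, p1, and_self])

/-- If any two elements are joined by a path of comparable pairs that split, then `Th` is the
whole kernel of the first projection. -/
theorem IsMix.th_of_fst_eq (h : IsMix a b f) (hTh : IsSquareCongruence Th)
    (hDe : IsSquareCongruence De) (hTh' : ∀ {x y}, Th x y → a x = a y)
    (hDe' : ∀ {x y}, De x y → b x = b y)
    (hconn : ∀ x y, Relation.ReflTransGen (fun u v => Comparable u v ∧ Split f Th De u v) x y)
    {x y : M} (hxy : a x = a y) : Th x y := by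
  let ET := fun u v => Th u v ∧ Comparable u v
  let ED := fun u v => De u v ∧ Comparable u v
  -- A path of `De`-steps followed by a `Th`-step.
  have push : ∀ {m y}, Relation.ReflTransGen ED m y → ∀ {z}, ET y z →
      ∃ n, ET m n ∧ Relation.ReflTransGen ED n z := by
    intro m y hm
    induction hm using Relation.ReflTransGen.head_induction_on with
    | refl => exact fun hz => ⟨_, hz, .refl⟩
    | head h1 _ ih =>
      intro z hz
      obtain ⟨n, hn, hn'⟩ := ih hz
      obtain ⟨k1, k2⟩ := h.exchange hTh hDe hTh' hDe' h1.1 h1.2 hn.1 hn.2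
      exact ⟨_, k1, .head k2 hn'⟩
  have main : ∀ {x y}, Relation.ReflTransGen (fun u v => Comparable u v ∧ Split f Th De u v) x y →
      ∃ n, Th x n ∧ Relation.ReflTransGen ED n y := by
    intro x y hxy
    induction hxy with
    | refl => exact ⟨_, hTh.equiv.refl _, .refl⟩
    | @tail y z _ hyz ih =>
      obtain ⟨n, hn, hn'⟩ := ih
      obtain ⟨hc, hs⟩ := hyz
      have hc2 : Comparable y (f y z) ∧ Comparable (f y z) z := by
        rcases hc with hc | hc <;> obtain ⟨p1, p2⟩ := h.le_iff.1 hc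
        · exact ⟨Or.inl (h.le_iff.2 (by simp only [h.fst_mix, h.snd_mix, mul_self, p2, and_self])),
            Or.inl (h.le_iff.2 (by simp only [h.fst_mix, h.snd_mix, mul_self, p1, and_self]))⟩
        · exact ⟨Or.inr (h.le_iff.2 (by simp only [h.fst_mix, h.snd_mix, mul_self, p2, and_self])),
            Or.inr (h.le_iff.2 (by simp only [h.fst_mix, h.snd_mix, mul_self, p1, and_self]))⟩
      obtain ⟨n', k1, k2⟩ := push hn' ⟨hs.th_left, hc2.1⟩
      exact ⟨n', hTh.equiv.trans hn k1.1, k2.tail ⟨hs.de_right, hc2.2⟩⟩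
  obtain ⟨n, hn, hny⟩ := main (hconn x y)
  have hb : b n = b y := by
    clear hn
    induction hny using Relation.ReflTransGen.head_induction_on with
    | refl => rfl
    | head h1 _ ih => exact (hDe' h1.1).trans ih
  rwa [h.ext ((hTh' hn).symm.trans hxy) hb] at hn

end Mix
end RelSemilattice

open FirstOrder FirstOrder.Language FirstOrder.Language.Structure

/-! ### Decomposition operations and generated congruences -/

instance RelSemilattice.pi {I : Type*} {M : I → Type*} [∀ i, RelSemilattice (M i)] :
    RelSemilattice (∀ i, M i) where
  mul_self x := funext fun i => RelSemilattice.mul_self (x i)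
  mul_mul_comm x y z := funext fun i => RelSemilattice.mul_mul_comm (x i) (y i) (z i)

section Certificates

variable {L : FirstOrder.Language.{u, v}} {A : Type w} [L.Structure A]

/-- A decomposition operation: `f x y` has the first coordinate of `x` and the second coordinate
of `y` with respect to some decomposition of `A` into a direct product of two algebras. -/
structure IsDecomposition (L : FirstOrder.Language.{u, v}) {A : Type w} [L.Structure A]
    (f : A → A → A) : Prop where
  self : ∀ x, f x x = x
  left : ∀ x y z, f (f x y) z = f x z
  right : ∀ x y z, f x (f y z) = f x z
  map : ∀ {n} (F : L.Functions n) (x y : Fin n → A),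
    f (funMap F x) (funMap F y) = funMap F fun i => f (x i) (y i)

theorem IsDecomposition.flip {f : A → A → A} (h : IsDecomposition L f) :
    IsDecomposition L fun x y => f y x :=
  ⟨h.self, fun x y z => h.right z y x, fun x y z => h.left z y x, fun F x y => h.map F y x⟩

theorem IsDecomposition.realize {f : A → A → A} (h : IsDecomposition L f) {α : Type*}
    (s : L.Term α) (x y : α → A) :
    f (s.realize x) (s.realize y) = s.realize fun i => f (x i) (y i) := by
  induction s with
  | var => rfl
  | func F ts ih => simp only [Term.realize, h.map, ih]

variable (t : L.Term (Fin 2))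

theorem IsDecomposition.map_mul {f : A → A → A} (h : IsDecomposition L f) (x y x' y' : A) :
    f (mul t x y) (mul t x' y') = mul t (f x x') (f y y') := by
  unfold mul
  rw [h.realize]
  congr 1
  funext i
  fin_cases i <;> rfl

theorem IsDecomposition.fst_eq_iff {f : A → A → A} (h : IsDecomposition L f) {x y : A} :
    (fun z => f x z) = (fun z => f y z) ↔ f x y = y := by
  refine ⟨fun e => ?_, fun e => funext fun z => ?_⟩
  · exact (congrFun e y).trans (h.self y)
  · rw [← h.left x y z, e]

theorem IsDecomposition.snd_eq_iff {f : A → A → A} (h : IsDecomposition L f) {x y : A} :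
    (fun z => f z x) = (fun z => f z y) ↔ f x y = x := by
  refine ⟨fun e => ?_, fun e => funext fun z => ?_⟩
  · exact (congrFun e x).symm.trans (h.self x)
  · rw [← h.right z x y, e]

/-- An algebra satisfying the identities of relative semilattices, as a semigroup. -/
@[reducible]
def IsRelativeSemilattice.toRelSemilattice {t : L.Term (Fin 2)}
    (h : IsRelativeSemilattice t A) : RelSemilattice A where
  mul := mul t
  mul_assoc := h.1
  mul_self := h.2.1
  mul_mul_comm := h.2.2

/-- The curried forms of `f` serve as the two projections: `A` is identified with a subset of
`(A → A) × (A → A)`. -/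
theorem IsDecomposition.isMix {f : A → A → A} (h : IsDecomposition L f)
    (hA : IsRelativeSemilattice t A) :
    letI := hA.toRelSemilattice
    RelSemilattice.IsMix (fun x z => f x z) (fun x z => f z x) f := by
  let _ := hA.toRelSemilattice
  refine ⟨fun x y => funext fun z => ?_, fun x y => funext fun z => ?_, fun x y => ?_,
    fun x y => ?_, fun {x y} h1 h2 => ?_⟩
  · exact (congrArg _ (hA.2.1 z).symm).trans (h.map_mul t x y z z)
  · exact (congrArg (fun z' => f z' (mul t x y)) (hA.2.1 z).symm).trans (h.map_mul t z z x y)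
  · exact funext fun z => h.left x y z
  · exact funext fun z => h.right z x y
  · rw [← h.snd_eq_iff.1 h2, h.fst_eq_iff.1 h1]

/-- The square relation `RelSemilattice.IsSquare` for the operation given by the term `t`. -/
def Square (q p s e : A) : Prop :=
  mul t p e = p ∧ mul t s e = s ∧ mul t p s = q ∧
    ∀ v, mul t p v = p → mul t s v = s → mul t e v = e

/-- A relation compatible with the basic operations. -/
def Compatible (L : FirstOrder.Language.{u, v}) {A : Type w} [L.Structure A]
    (R : A → A → Prop) : Prop :=
  ∀ (F : Σ n, L.Functions n) (x y : Fin F.1 → A), (∀ i, R (x i) (y i)) →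
    R (funMap F.2 x) (funMap F.2 y)

theorem Compatible.realize {R : A → A → Prop} (h : Compatible L R) {α : Type*}
    (s : L.Term α) {x y : α → A} (hxy : ∀ i, R (x i) (y i)) : R (s.realize x) (s.realize y) := by
  induction s with
  | var => exact hxy _
  | func F ts ih => exact h ⟨_, F⟩ _ _ ih

/-- To generate a congruence it suffices to move one argument of an operation at a time. -/
theorem Compatible.reflTransGen {R : A → A → Prop}
    (h : ∀ (F : Σ n, L.Functions n) (x : Fin F.1 → A) (i : Fin F.1) (a b : A), R a b →
      R (funMap F.2 (Function.update x i a)) (funMap F.2 (Function.update x i b))) :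
    Compatible L (Relation.ReflTransGen R) := by
  classical
  intro F x y hxy
  have key : ∀ s : Finset (Fin F.1), Relation.ReflTransGen R (funMap F.2 x)
      (funMap F.2 fun i => if i ∈ s then y i else x i) := by
    intro s
    induction s using Finset.induction_on with
    | empty => simpa using Relation.ReflTransGen.refl
    | insert i s hi ih =>
      refine ih.trans ?_
      have e : ∀ g : Fin F.1 → A, g i = x i →
          g = Function.update g i (x i) := fun g hg => by rw [← hg, Function.update_eq_self]
      have e1 := e (fun j => if j ∈ s then y j else x j) (by simp [hi])
      have e2 : (fun j => if j ∈ insert i s then y j else x j) =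
          Function.update (fun j => if j ∈ s then y j else x j) i (y i) := by
        funext j
        rcases eq_or_ne j i with rfl | hj
        · simp
        · simp [hj]
      rw [e2]
      nth_rewrite 1 [e1]
      exact Relation.ReflTransGen.lift (fun a => funMap F.2 (Function.update _ i a))
        (fun a b hab => h F _ i a b hab) _ _ (hxy i)
  simpa using key Finset.univ

/-- A congruence which transfers between opposite sides of squares. -/
structure IsSquareCongruence (R : A → A → Prop) : Prop where
  equiv : Equivalence R
  compat : Compatible L R
  square : ∀ {q p s e}, Square t q p s e → (R q p ↔ R s e)

variable {t}

theorem IsSquareCongruence.toRel {R : A → A → Prop} (hA : IsRelativeSemilattice t A)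
    (h : IsSquareCongruence t R) :
    letI := hA.toRelSemilattice
    RelSemilattice.IsSquareCongruence R := by
  let _ := hA.toRelSemilattice
  refine ⟨h.equiv, fun {x x' y y'} hx hy => h.compat.realize t fun i => ?_,
    fun sq => h.square ⟨sq.left_le, sq.right_le, sq.meet, sq.lub⟩⟩
  fin_cases i <;> assumption

theorem IsDecomposition.isSquareCongruence {f : A → A → A} (h : IsDecomposition L f)
    (hA : IsRelativeSemilattice t A) : IsSquareCongruence t fun x y => f x y = y := by
  let _ := hA.toRelSemilattice
  have := (h.isMix t hA).isSquareCongruence_fst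
  simp only [h.fst_eq_iff] at this
  exact ⟨this.equiv, fun F x y hxy => by rw [h.map]; simp only [hxy],
    fun sq => this.square ⟨sq.1, sq.2.1, sq.2.2.1, sq.2.2.2⟩⟩

variable (t)

/-- Stage `n` of the generation of the least square congruence that contains `base`. -/
def Stage (base : A → A → Prop) : ℕ → A → A → Prop
  | 0 => fun x y => x = y ∨ base x y
  | n + 1 => fun x y => Stage base n x y ∨ Stage base n y x ∨
      (∃ z, Stage base n x z ∧ Stage base n z y) ∨
      (∃ F : Σ k, L.Functions k, ∃ a b : Fin F.1 → A,
        (∀ i, Stage base n (a i) (b i)) ∧ funMap F.2 a = x ∧ funMap F.2 b = y) ∨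
      (∃ s e, Stage base n s e ∧ Square t x y s e) ∨
      (∃ q p, Stage base n q p ∧ Square t q p x y)

variable {t}

theorem Stage.mono {base : A → A → Prop} {m n : ℕ} (hmn : m ≤ n) {x y : A}
    (h : Stage t base m x y) : Stage t base n x y := by
  induction hmn with
  | refl => exact h
  | step _ ih => exact Or.inl ih

theorem isSquareCongruence_stage (base : A → A → Prop) :
    IsSquareCongruence t fun x y => ∃ n, Stage t base n x y where
  equiv := by
    refine ⟨fun x => ⟨0, Or.inl rfl⟩, fun ⟨n, h⟩ => ⟨n + 1, Or.inr (Or.inl h)⟩, ?_⟩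
    rintro x y z ⟨m, h1⟩ ⟨n, h2⟩
    exact ⟨max m n + 1, Or.inr (Or.inr (Or.inl
      ⟨y, h1.mono (le_max_left _ _), h2.mono (le_max_right _ _)⟩))⟩
  compat := by
    intro F x y hxy
    choose n hn using hxy
    refine ⟨(Finset.univ.sup n) + 1,
      Or.inr (Or.inr (Or.inr (Or.inl ⟨F, x, y, fun i => ?_, rfl, rfl⟩)))⟩
    exact (hn i).mono (Finset.le_sup (f := n) (Finset.mem_univ i))
  square := by
    intro q p s e sq
    constructor
    · rintro ⟨n, h⟩
      exact ⟨n + 1, Or.inr (Or.inr (Or.inr (Or.inr (Or.inr ⟨q, p, h, sq⟩))))⟩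
    · rintro ⟨n, h⟩
      exact ⟨n + 1, Or.inr (Or.inr (Or.inr (Or.inr (Or.inl ⟨s, e, h, sq⟩))))⟩

/-- Stages of the generation are sound. -/
theorem IsSquareCongruence.stage_le {R base : A → A → Prop} (hR : IsSquareCongruence t R)
    (hbase : ∀ x y, base x y → R x y) {n : ℕ} {x y : A} (h : Stage t base n x y) : R x y := by
  induction n generalizing x y with
  | zero =>
    rcases h with rfl | h
    · exact hR.equiv.refl x
    · exact hbase _ _ h
  | succ n ih =>
    rcases h with h | h | ⟨z, h1, h2⟩ | ⟨F, a, b, h, rfl, rfl⟩ | ⟨s, e, h, sq⟩ | ⟨q, p, h, sq⟩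
    · exact ih h
    · exact hR.equiv.symm (ih h)
    · exact hR.equiv.trans (ih h1) (ih h2)
    · exact hR.compat F a b fun i => ih (h i)
    · exact (hR.square sq).2 (ih h)
    · exact (hR.square sq).1 (ih h)

/-- A path from `x` to `y` of length `ℓ` in the comparability graph that is given uniformly by
binary terms. -/
structure IsPath (t : L.Term (Fin 2)) (ℓ : ℕ) (p : ℕ → L.Term (Fin 2)) (A : Type w)
    [L.Structure A] : Prop where
  zero : ∀ x y : A, mul (p 0) x y = x
  last : ∀ x y : A, mul (p ℓ) x y = y
  step : ∀ k < ℓ, (∀ x y : A, rel t (mul (p k) x y) (mul (p (k + 1)) x y)) ∨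
    ∀ x y : A, rel t (mul (p (k + 1)) x y) (mul (p k) x y)

/-- The form in which semidegeneracy is used: a congruence that has a subalgebra as one of its
classes is total. -/
def NoProperSubalgebraClass (L : FirstOrder.Language.{u, v}) (A : Type w) [L.Structure A] : Prop :=
  ∀ Q : A → A → Prop, Equivalence Q → Compatible L Q →
    ∀ w, (∀ F : Σ n, L.Functions n, Q w (funMap F.2 fun _ => w)) → ∀ x y, Q x y

open RelSemilattice in
/-- If `Th` and `De` are square congruences below the kernels of the two projections, and
sufficiently many pairs of elements of the subalgebra generated by one element `w` split, then `Th`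
is the kernel of the first projection. The statement for `De` follows by flipping `f`. -/
theorem IsDecomposition.th_of_split {f : A → A → A} (h : IsDecomposition L f)
    (hA : IsRelativeSemilattice t A) {ℓ : ℕ} {p : ℕ → L.Term (Fin 2)} (hp : IsPath t ℓ p A)
    (hQ : NoProperSubalgebraClass L A) {Th De : A → A → Prop}
    (hTh : IsSquareCongruence t Th) (hDe : IsSquareCongruence t De)
    (hTh' : ∀ {x y}, Th x y → f x y = y) (hDe' : ∀ {x y}, De x y → f x y = x) (w : A)
    (hpath : ∀ k < ℓ, Split f Th De (mul (p k) w w) (mul (p (k + 1)) w w))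
    (hfun : ∀ F : Σ n, L.Functions n, Split f Th De w (funMap F.2 fun _ => w))
    {x y : A} (hxy : f x y = y) : Th x y := by
  let _ := hA.toRelSemilattice
  have hmix := h.isMix t hA
  have kTh := hTh.toRel hA
  have kDe := hDe.toRel hA
  have aTh : ∀ {x y}, Th x y → (fun z => f x z) = (fun z => f y z) :=
    fun h' => h.fst_eq_iff.2 (hTh' h')
  have aDe : ∀ {x y}, De x y → (fun z => f z x) = (fun z => f z y) :=
    fun h' => h.snd_eq_iff.2 (hDe' h')
  -- The join of the two congruences has a subalgebra as the class of `w`.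
  have htotal : ∀ x y, Relation.ReflTransGen (fun x y => Th x y ∨ De x y) x y := by
    have hsym : ∀ {x y}, Relation.ReflTransGen (fun x y => Th x y ∨ De x y) x y →
        Relation.ReflTransGen (fun x y => Th x y ∨ De x y) y x := by
      intro x y hxy
      induction hxy with
      | refl => exact .refl
      | tail _ h ih =>
        exact .head (h.imp (fun h => kTh.equiv.symm h) (fun h => kDe.equiv.symm h)) ih
    refine hQ _ ⟨fun x => .refl, hsym, fun h1 h2 => h1.trans h2⟩ ?_ w fun F => ?_
    · refine Compatible.reflTransGen fun F x i a b hab => ?_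
      have aux : ∀ {R : A → A → Prop}, Equivalence R → R a b →
          ∀ j, R (Function.update x i a j) (Function.update x i b j) := by
        intro R hR hab j
        rcases eq_or_ne j i with rfl | hj
        · simpa using hab
        · simpa [hj] using hR.refl _
      exact hab.imp (fun h => hTh.compat F _ _ (aux kTh.equiv h))
        (fun h => hDe.compat F _ _ (aux kDe.equiv h))
    · have := hfun F
      exact .head (Or.inl this.th_left) (.single (Or.inr this.de_right))
  -- Splitting propagates from `w` to all elements.
  have hdiag : ∀ z, ∀ k < ℓ, Split f Th De (mul (p k) z z) (mul (p (k + 1)) z z) := by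
    intro z
    induction htotal w z with
    | refl => exact hpath
    | @tail y z _ hyz ih =>
      intro k hk
      have hord : ∀ u v : A, (mul (p k) y y * mul (p (k + 1)) y y = mul (p k) y y ∧
          mul (p k) u v * mul (p (k + 1)) u v = mul (p k) u v) ∨
          (mul (p (k + 1)) y y * mul (p k) y y = mul (p (k + 1)) y y ∧
          mul (p (k + 1)) u v * mul (p k) u v = mul (p (k + 1)) u v) := fun u v =>
        (hp.step k hk).imp (fun h => ⟨h y y, h u v⟩) (fun h => ⟨h y y, h u v⟩)
      rcases hyz with hyz | hyz
      · have hmove : ∀ s : L.Term (Fin 2), Th (mul s y y) (mul s z z) := fun s =>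
          hTh.compat.realize s fun i => by fin_cases i <;> exact hyz
        exact (hmix.flip.split_of_comparable kDe kTh aTh (hord z z) (hmove _) (hmove _)
          (ih k hk).flip).flip
      · have hmove : ∀ s : L.Term (Fin 2), De (mul s y y) (mul s z z) := fun s =>
          hDe.compat.realize s fun i => by fin_cases i <;> exact hyz
        exact hmix.split_of_comparable kTh kDe aDe (hord z z) (hmove _) (hmove _) (ih k hk)
  -- Related elements are joined by a path of comparable pairs that split: compare the path from
  -- `x` to `y` with the closed path from `x` to `x`.
  have hstep : ∀ {x y}, Th x y ∨ De x y → ∀ k < ℓ,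
      Comparable (mul (p k) x y) (mul (p (k + 1)) x y) ∧
        Split f Th De (mul (p k) x y) (mul (p (k + 1)) x y) := by
    intro x y hxy k hk
    refine ⟨(hp.step k hk).imp (fun h => h x y) (fun h => h x y), ?_⟩
    have hord : (mul (p k) x x * mul (p (k + 1)) x x = mul (p k) x x ∧
          mul (p k) x y * mul (p (k + 1)) x y = mul (p k) x y) ∨
          (mul (p (k + 1)) x x * mul (p k) x x = mul (p (k + 1)) x x ∧
          mul (p (k + 1)) x y * mul (p k) x y = mul (p (k + 1)) x y) :=
      (hp.step k hk).imp (fun h => ⟨h x x, h x y⟩) (fun h => ⟨h x x, h x y⟩)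
    rcases hxy with hxy | hxy
    · have hmove : ∀ s : L.Term (Fin 2), Th (mul s x x) (mul s x y) := fun s =>
        hTh.compat.realize s fun i => by
          fin_cases i
          exacts [kTh.equiv.refl x, hxy]
      exact (hmix.flip.split_of_comparable kDe kTh aTh hord (hmove _) (hmove _)
        (hdiag x k hk).flip).flip
    · have hmove : ∀ s : L.Term (Fin 2), De (mul s x x) (mul s x y) := fun s =>
        hDe.compat.realize s fun i => by
          fin_cases i
          exacts [kDe.equiv.refl x, hxy]
      exact hmix.split_of_comparable kTh kDe aDe hord (hmove _) (hmove _) (hdiag x k hk)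
  refine hmix.th_of_fst_eq kTh kDe aTh aDe (fun x y => ?_) (h.fst_eq_iff.2 hxy)
  induction htotal x y with
  | refl => exact .refl
  | @tail y z _ hyz ih =>
    refine ih.trans ?_
    have : ∀ k ≤ ℓ, Relation.ReflTransGen (fun u v => Comparable u v ∧ Split f Th De u v) y
        (mul (p k) y z) := by
      intro k
      induction k with
      | zero => intro _; rw [hp.zero]
      | succ k ih => exact fun hk => (ih (by omega)).tail (hstep hyz k (by omega))
    simpa only [hp.last] using this ℓ le_rfl

end Certificates

/-! ### Quotients, free algebras and ultraproducts in the variety -/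

section Variety

variable {L : FirstOrder.Language.{u, v}} {E : Set (Identity L)}

theorem realize_identity_sentence {A : Type*} [L.Structure A] (e : Identity L) :
    A ⊨ e.sentence ↔ ∀ v : Fin e.arity → A, e.lhs.realize v = e.rhs.realize v := by
  simp only [Identity.sentence, Sentence.Realize, BoundedFormula.realize_alls,
    BoundedFormula.realize_bdEqual, Term.realize_relabel, Sum.elim_comp_inr]

theorem models_axiomsOf {A : Type*} [L.Structure A] :
    A ⊨ axiomsOf E ↔ ∀ e ∈ E, ∀ v : Fin e.arity → A, e.lhs.realize v = e.rhs.realize v := by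
  simp only [Theory.model_iff, axiomsOf, Set.forall_mem_image, realize_identity_sentence]

variable [L.IsAlgebraic]

/-- The quotient of an algebra by a congruence. -/
@[reducible]
def quotientPrestructure {A : Type w} [L.Structure A] (s : Setoid A)
    (h : Compatible L fun x y => s x y) : L.Prestructure s where
  toStructure := inferInstance
  fun_equiv x y hxy := h ⟨_, _⟩ x y hxy
  rel_equiv {_ r} := isEmptyElim r

theorem models_quotient {A : Type w} [L.Structure A] (s : Setoid A)
    (h : Compatible L fun x y => s x y) (hA : A ⊨ axiomsOf E) :
    letI := quotientPrestructure s h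
    (Quotient s) ⊨ axiomsOf E := by
  let _ := quotientPrestructure s h
  rw [models_axiomsOf] at hA ⊢
  intro e he v
  obtain ⟨v', rfl⟩ : ∃ v' : Fin e.arity → A, v = fun i => ⟦v' i⟧ :=
    ⟨fun i => (v i).out, funext fun i => (Quotient.out_eq _).symm⟩
  rw [Term.realize_quotient_mk', Term.realize_quotient_mk']
  exact congrArg _ (hA e he v')

theorem Semidegenerate.noProperSubalgebraClass (hE : Semidegenerate.{u, v, w} E) {A : Type w}
    [L.Structure A] (hA : A ⊨ axiomsOf E) : NoProperSubalgebraClass L A := by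
  intro Q hQ hQc w hw x y
  by_contra hxy
  let s : Setoid A := ⟨Q, hQ⟩
  let _ := quotientPrestructure s hQc
  have hnt : Nontrivial (Quotient s) := ⟨⟦x⟧, ⟦y⟧, fun h => hxy (Quotient.exact h)⟩
  let S : L.Substructure (Quotient s) :=
    ⟨{⟦w⟧}, fun {n} F x hx => by
      have : x = fun _ => ⟦w⟧ := funext hx
      rw [this, funMap_quotient_mk']
      exact Quotient.sound (hQ.symm (hw ⟨n, F⟩))⟩
  exact hE (Quotient s) (models_quotient s hQc hA) hnt S ⟦w⟧ rfl

/-- The term algebra. -/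
@[reducible]
def termStructure (L : FirstOrder.Language.{u, v}) [L.IsAlgebraic] (α : Type*) :
    L.Structure (L.Term α) where
  funMap := Term.func
  RelMap r := isEmptyElim r

theorem realize_realize_term {α β : Type*} {A : Type*} [L.Structure A] (s : L.Term β)
    (σ : β → L.Term α) (v : α → A) :
    (@Term.realize L _ (termStructure L α) _ σ s).realize v =
      s.realize fun i => (σ i).realize v := by
  induction s with
  | var => rfl
  | func F ts ih =>
    simp only [Term.realize]
    exact congrArg _ (funext ih)

/-- If the comparability graph of every algebra in the variety is connected then the free algebra
on two generators yields a uniform path between two elements. -/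
theorem exists_isPath [Finite L.Symbols] (t : L.Term (Fin 2))
    (hconn : ∀ (A : Type w) [L.Structure A] [Nonempty A], A ⊨ axiomsOf E → IsConnected t A) :
    ∃ (ℓ : ℕ) (p : ℕ → L.Term (Fin 2)), ∀ (A : Type w) [L.Structure A] [Nonempty A],
      A ⊨ axiomsOf E → IsPath t ℓ p A := by
  let s : Setoid (L.Term (Fin 2)) :=
    { r := fun p q => ∀ (A : Type w) [L.Structure A] [Nonempty A], A ⊨ axiomsOf E →
        ∀ v : Fin 2 → A, p.realize v = q.realize v
      iseqv := ⟨fun _ _ _ _ _ _ => rfl, fun h A _ _ hA v => (h A hA v).symm,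
        fun h1 h2 A _ _ hA v => (h1 A hA v).trans (h2 A hA v)⟩ }
  let _ := termStructure L (Fin 2)
  let _ : L.Prestructure s := quotientPrestructure s fun F x y hxy A _ _ hA v => by
    change funMap F.2 (fun i => (x i).realize v) = funMap F.2 fun i => (y i).realize v
    exact congrArg _ (funext fun i => hxy i A hA v)
  have hF : (Quotient s) ⊨ axiomsOf E := by
    rw [models_axiomsOf]
    intro e he v
    obtain ⟨v', rfl⟩ : ∃ v' : Fin e.arity → L.Term (Fin 2), v = fun i => ⟦v' i⟧ :=
      ⟨fun i => (v i).out, funext fun i => (Quotient.out_eq _).symm⟩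
    rw [Term.realize_quotient_mk', Term.realize_quotient_mk']
    refine Quotient.sound fun A _ _ hA v => ?_
    rw [realize_realize_term, realize_realize_term]
    exact models_axiomsOf.1 hA e he _
  have : Countable (Quotient s) := inferInstance
  -- The free algebra is countable, hence has a copy in the given universe.
  let eq : Quotient s ≃ Shrink.{w} (Quotient s) := equivShrink _
  let _ : L.Structure (Shrink.{w} (Quotient s)) := eq.inducedStructure
  let φ : Quotient s ≃[L] Shrink.{w} (Quotient s) := eq.inducedStructureEquiv
  have hφ : ∀ {β : Type} (e : L.Term β) (x : β → L.Term (Fin 2)),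
      (e.realize fun i => φ ⟦x i⟧) = φ ⟦e.realize x⟧ := by
    intro β e x
    rw [← Term.realize_quotient_mk']
    exact HomClass.realize_term φ
  have hF' : (Shrink.{w} (Quotient s)) ⊨ axiomsOf E := by
    rw [models_axiomsOf] at hF ⊢
    intro e he v
    obtain ⟨v', rfl⟩ : ∃ v' : Fin e.arity → L.Term (Fin 2), v = fun i => φ ⟦v' i⟧ :=
      ⟨fun i => (φ.symm (v i)).out, funext fun i => by rw [Quotient.out_eq, φ.apply_symm_apply]⟩
    rw [hφ, hφ, ← Term.realize_quotient_mk', ← Term.realize_quotient_mk', hF e he]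
  have : Nonempty (Shrink.{w} (Quotient s)) := ⟨φ ⟦Term.var 0⟧⟩
  obtain ⟨W⟩ := (hconn _ hF').preconnected (φ ⟦Term.var 0⟧) (φ ⟦Term.var 1⟧)
  let p : ℕ → L.Term (Fin 2) := fun k => (φ.symm (W.getVert k)).out
  have hp : ∀ k, φ ⟦p k⟧ = W.getVert k := fun k => by
    rw [Quotient.out_eq, φ.apply_symm_apply]
  have hinj : ∀ {a b : L.Term (Fin 2)}, φ ⟦a⟧ = φ ⟦b⟧ → s a b := fun h =>
    Quotient.exact (φ.injective h)
  refine ⟨W.length, p, fun A _ _ hA => ⟨fun x y => ?_, fun x y => ?_, fun k hk => ?_⟩⟩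
  · exact hinj ((hp 0).trans W.getVert_zero) A hA ![x, y]
  · exact hinj ((hp _).trans W.getVert_length) A hA ![x, y]
  · have hrel : ∀ a b : L.Term (Fin 2), rel t (φ ⟦a⟧) (φ ⟦b⟧) → ∀ x y : A,
        rel t (mul a x y) (mul b x y) := by
      intro a b hab x y
      have e1 : (t.realize fun i => φ ⟦![a, b] i⟧) = φ ⟦a⟧ := by
        rw [← hab]
        unfold mul
        congr 1
        funext i
        fin_cases i <;> rfl
      rw [hφ] at e1
      have e2 := hinj e1 A hA ![x, y]
      rw [realize_realize_term] at e2
      refine Eq.trans ?_ e2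
      unfold mul
      congr 1
      funext i
      fin_cases i <;> rfl
    have hadj := (W.adj_getVert_succ hk).2
    rw [← hp k, ← hp (k + 1)] at hadj
    exact hadj.imp (hrel _ _) (hrel _ _)

/-- The generating relation: the `i`-th pair of unary terms, evaluated at `w`, gives elements
`a_i` and `b_i`; the elements `m i` and `m' i` are meant as the two mixtures of them. -/
def base {N : ℕ} (r r' : Fin N → L.Term Unit) {A : Type w} [L.Structure A] (w : A)
    (m m' : Fin N → A) (x y : A) : Prop :=
  ∃ i, (x = (r i).realize (fun _ => w) ∧ y = m i) ∨ (x = m' i ∧ y = (r' i).realize fun _ => w)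

/-- The mixtures of the values at `w` of pairs of unary terms. -/
def mixtures {N : ℕ} (r r' : Fin N → L.Term Unit) {A : Type w} [L.Structure A] (f : A → A → A)
    (w : A) (i : Fin N) : A :=
  f ((r i).realize fun _ => w) ((r' i).realize fun _ => w)

variable {t : L.Term (Fin 2)} {N : ℕ} {r r' : Fin N → L.Term Unit}

omit [L.IsAlgebraic] in
theorem IsDecomposition.stage_sound {A : Type w} [L.Structure A]
    (hA : IsRelativeSemilattice t A) {f : A → A → A} (hf : IsDecomposition L f) {w : A} {n : ℕ}
    {x y : A} (h : Stage t (base r r' w (mixtures r r' f w) (mixtures r' r f w)) n x y) :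
    f x y = y := by
  refine (hf.isSquareCongruence hA).stage_le ?_ h
  rintro x y ⟨i, ⟨rfl, rfl⟩ | ⟨rfl, rfl⟩⟩
  · rw [mixtures, hf.right]
  · rw [mixtures, hf.left, hf.self]

/-- The pairs of unary terms whose mixtures are needed to generate the factor congruences. -/
structure IsSplittingFamily (r r' : Fin N → L.Term Unit) (ℓ : ℕ) (p : ℕ → L.Term (Fin 2)) :
    Prop where
  path : ∀ k < ℓ, ∃ i, r i = (p k).relabel (fun _ => ()) ∧ r' i = (p (k + 1)).relabel fun _ => ()
  func : ∀ F : Σ n, L.Functions n, ∃ i, r i = Term.var () ∧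
    r' i = Term.func F.2 fun _ => Term.var ()

omit [L.IsAlgebraic] in
theorem exists_isSplittingFamily [Finite L.Symbols] (ℓ : ℕ) (p : ℕ → L.Term (Fin 2)) :
    ∃ (N : ℕ) (r r' : Fin N → L.Term Unit), IsSplittingFamily r r' ℓ p := by
  have : Finite (Σ n, L.Functions n) := Finite.of_injective (Sum.inl : _ → L.Symbols)
    Sum.inl_injective
  let e := Finite.equivFin (Fin ℓ ⊕ Σ n, L.Functions n)
  refine ⟨_, fun i => Sum.elim (fun k : Fin ℓ => (p k).relabel fun _ => ())
    (fun _ => Term.var ()) (e.symm i), fun i => Sum.elim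
    (fun k : Fin ℓ => (p (k + 1)).relabel fun _ => ())
    (fun F : Σ n, L.Functions n => Term.func F.2 fun _ => Term.var ()) (e.symm i),
    ⟨fun k hk => ?_, fun F => ?_⟩⟩
  · exact ⟨e (Sum.inl ⟨k, hk⟩), by simp⟩
  · exact ⟨e (Sum.inr F), by simp⟩

omit [L.IsAlgebraic] in
/-- The generated relation is the whole kernel of the first projection. -/
theorem IsDecomposition.exists_stage {A : Type w} [L.Structure A]
    (hA : IsRelativeSemilattice t A) {ℓ : ℕ} {p : ℕ → L.Term (Fin 2)} (hp : IsPath t ℓ p A)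
    (hQ : NoProperSubalgebraClass L A) (hr : IsSplittingFamily r r' ℓ p)
    {f : A → A → A} (hf : IsDecomposition L f) (w : A) {x y : A} (hxy : f x y = y) :
    ∃ n, Stage t (base r r' w (mixtures r r' f w) (mixtures r' r f w)) n x y := by
  have hTh := isSquareCongruence_stage (t := t)
    (base r r' w (mixtures r r' f w) (mixtures r' r f w))
  have hDe := isSquareCongruence_stage (t := t)
    (base r r' w (mixtures r' r f w) (mixtures r r' f w))
  have hsplit : ∀ i, RelSemilattice.Split f
      (fun x y => ∃ n, Stage t (base r r' w (mixtures r r' f w) (mixtures r' r f w)) n x y)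
      (fun x y => ∃ n, Stage t (base r r' w (mixtures r' r f w) (mixtures r r' f w)) n x y)
      ((r i).realize fun _ => w) ((r' i).realize fun _ => w) := fun i =>
    ⟨⟨0, Or.inr ⟨i, Or.inl ⟨rfl, rfl⟩⟩⟩, ⟨0, Or.inr ⟨i, Or.inr ⟨rfl, rfl⟩⟩⟩,
      ⟨0, Or.inr ⟨i, Or.inl ⟨rfl, rfl⟩⟩⟩, ⟨0, Or.inr ⟨i, Or.inr ⟨rfl, rfl⟩⟩⟩⟩
  refine hf.th_of_split hA hp hQ hTh hDe (fun ⟨n, h⟩ => hf.stage_sound hA h)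
    (fun {x y} ⟨n, h⟩ => ?_) w (fun k hk => ?_) (fun F => ?_) hxy
  · have : f y x = y := hf.flip.stage_sound hA h
    rw [← this, hf.right, hf.self]
  · obtain ⟨i, h1, h2⟩ := hr.path k hk
    have := hsplit i
    rw [h1, h2, Term.realize_relabel, Term.realize_relabel] at this
    have e : ![w, w] = (fun _ : Unit => w) ∘ fun _ : Fin 2 => () := by
      funext i
      fin_cases i <;> rfl
    unfold mul
    rwa [e]
  · obtain ⟨i, h1, h2⟩ := hr.func F
    have := hsplit i
    rwa [h1, h2] at this

omit [L.IsAlgebraic] in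
open Filter in
/-- By compactness, a single stage of the generation suffices throughout the variety. -/
theorem exists_uniform_stage {ℓ : ℕ} {p : ℕ → L.Term (Fin 2)} (hr : IsSplittingFamily r r' ℓ p)
    (hV : ∀ (A : Type w) [L.Structure A] [Nonempty A], A ⊨ axiomsOf E →
      IsRelativeSemilattice t A ∧ IsPath t ℓ p A ∧ NoProperSubalgebraClass L A)
    (hdef : ∀ n, ∃ χ : L.Formula (Fin 3 ⊕ Fin N ⊕ Fin N), ∀ (A : Type w) [L.Structure A]
      [Nonempty A] (v : Fin 3 ⊕ Fin N ⊕ Fin N → A), χ.Realize v ↔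
        Stage t (base r r' (v (.inl 0)) (fun i => v (.inr (.inl i))) (fun i => v (.inr (.inr i)))) n
          (v (.inl 1)) (v (.inl 2))) :
    ∃ n, ∀ (A : Type w) [L.Structure A] [Nonempty A], A ⊨ axiomsOf E → ∀ f : A → A → A,
      IsDecomposition L f → ∀ w x y : A, f x y = y →
        Stage t (base r r' w (mixtures r r' f w) (mixtures r' r f w)) n x y := by
  by_contra! hcon
  choose A iA nA hA f hf w x y hxy hn using hcon
  let U : Ultrafilter ℕ := hyperfilter ℕ
  have hU : ((U : Filter ℕ).Product A) ⊨ axiomsOf E := by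
    rw [Theory.model_iff]
    intro σ hσ
    rw [Ultraproduct.sentence_realize]
    exact Eventually.of_forall fun a => (hA a).realize_of_mem σ hσ
  obtain ⟨h1, h2, h3⟩ := hV _ hU
  obtain ⟨π, hπ, hterm, hfun, hform, g, hg⟩ : ∃ π : (∀ a, A a) → (U : Filter ℕ).Product A,
      Function.Surjective π ∧
      (∀ {α : Type} (e : L.Term α) (x : α → ∀ a, A a),
        (e.realize fun i => π (x i)) = π fun a => e.realize fun i => x i a) ∧
      (∀ {n : ℕ} (F : L.Functions n) (x : Fin n → ∀ a, A a),
        (funMap F fun i => π (x i)) = π fun a => funMap F fun i => x i a) ∧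
      (∀ {α : Type} (χ : L.Formula α) (x : α → ∀ a, A a),
        (χ.Realize fun i => π (x i)) ↔ ∀ᶠ a in U, χ.Realize fun i => x i a) ∧
      ∃ g : (U : Filter ℕ).Product A → (U : Filter ℕ).Product A → (U : Filter ℕ).Product A,
        ∀ x y, g (π x) (π y) = π fun a => f a (x a) (y a) := by
    let _ : Setoid (∀ a, A a) := (U : Filter ℕ).productSetoid A
    refine ⟨fun x => Quotient.mk' x, Quotient.mk'_surjective,
      fun e x => Ultraproduct.term_realize_cast x e, fun F x => Ultraproduct.funMap_cast F x,
      fun χ x => Ultraproduct.realize_formula_cast χ x,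
      Quotient.map₂ (fun x y a => f a (x a) (y a)) fun x x' hx y y' hy => ?_, fun _ _ => rfl⟩
    filter_upwards [hx, hy] with a h1 h2
    rw [h1, h2]
  have hgd : IsDecomposition L g := by
    refine ⟨hπ.forall.2 fun x => ?_,
      hπ.forall.2 fun x => hπ.forall.2 fun y => hπ.forall.2 fun z => ?_,
      hπ.forall.2 fun x => hπ.forall.2 fun y => hπ.forall.2 fun z => ?_, fun {n} F x y => ?_⟩
    · simp only [hg, (hf _).self]
    · simp only [hg, (hf _).left]
    · simp only [hg, (hf _).right]
    · choose x' hx using fun i => hπ (x i)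
      choose y' hy using fun i => hπ (y i)
      obtain rfl : (fun i => π (x' i)) = x := funext hx
      obtain rfl : (fun i => π (y' i)) = y := funext hy
      simp only [hfun, hg, (hf _).map]
  have hmix : ∀ s s' : Fin N → L.Term Unit, mixtures s s' g (π w) =
      fun i => π fun a => mixtures s s' (f a) (w a) i := by
    intro s s'
    funext i
    unfold mixtures
    rw [hterm _ fun _ => w, hterm _ fun _ => w, hg]
  obtain ⟨n, hstage⟩ := hgd.exists_stage h1 h2 h3 hr (π w) (x := π x) (y := π y)
    (by simp only [hg, hxy])
  rw [hmix, hmix] at hstage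
  obtain ⟨χ, hχ⟩ := hdef n
  let val : Fin 3 ⊕ Fin N ⊕ Fin N → ∀ a, A a :=
    Sum.elim ![w, x, y] (Sum.elim (fun i a => mixtures r r' (f a) (w a) i)
      (fun i a => mixtures r' r (f a) (w a) i))
  have hval := (hform χ val).1 ((hχ _ fun i => π (val i)).2 hstage)
  have hge : ∀ᶠ a in (U : Filter ℕ), n ≤ a :=
    (Nat.hyperfilter_le_atTop (eventually_ge_atTop n))
  obtain ⟨a, ha, hna⟩ := (hval.and hge).exists
  exact hn a (((hχ _ _).1 ha).mono hna)

end Variety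

/-! ### Definability by `Σ_k` formulas -/

section Definability

variable {L : FirstOrder.Language.{u, v}}

/-- A predicate, defined uniformly in all nonempty structures, of a tuple indexed by `α`. -/
abbrev Pred (L : FirstOrder.Language.{u, v}) (α : Type) :=
  ∀ (A : Type w) [L.Structure A] [Nonempty A], (α → A) → Prop

/-- Uniform definability by a `Σ_k` formula, in a semantic form: a `Σ_{k+1}` predicate is obtained
from the negation of a `Σ_k` predicate by quantifying a block of variables existentially. Blocks
are indexed by arbitrary finite types. -/
def SigmaDef : ℕ → ∀ {α : Type}, Pred.{u, v, w} L α → Prop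
  | 0, α, P => ∃ φ : L.Formula α, φ.IsQF ∧
      ∀ (A : Type w) [L.Structure A] [Nonempty A] (v : α → A), φ.Realize v ↔ P A v
  | k + 1, α, P => ∃ (β : Type) (_ : Finite β) (Q : Pred.{u, v, w} L (α ⊕ β)), SigmaDef k Q ∧
      ∀ (A : Type w) [L.Structure A] [Nonempty A] (v : α → A),
        P A v ↔ ∃ u : β → A, ¬ Q A (Sum.elim v u)

namespace SigmaDef

theorem congr {k : ℕ} {α : Type} {P P' : Pred.{u, v, w} L α} (h : SigmaDef k P)
    (hP : ∀ (A : Type w) [L.Structure A] [Nonempty A] (v : α → A), P' A v ↔ P A v) :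
    SigmaDef k P' := by
  have : P' = P := by
    funext A _ _ v
    exact propext (hP A v)
  rwa [this]

theorem reindex {k : ℕ} {α α' : Type} {P : Pred.{u, v, w} L α} (h : SigmaDef k P) (g : α → α') :
    SigmaDef k (fun A _ _ v => P A (v ∘ g) : Pred.{u, v, w} L α') := by
  induction k generalizing α α' with
  | zero =>
    obtain ⟨φ, hφ, h⟩ := h
    exact ⟨φ.relabel g, hφ.relabel _, fun A _ _ v => by rw [Formula.realize_relabel, h]⟩
  | succ k ih =>
    obtain ⟨β, hβ, Q, hQ, h⟩ := h
    refine ⟨β, hβ, _, ih hQ (Sum.map g id), fun A _ _ v => ?_⟩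
    simp only [h, Sum.elim_comp_map, Function.comp_id]

theorem neg {k : ℕ} {α : Type} {P : Pred.{u, v, w} L α} (h : SigmaDef k P) :
    SigmaDef (k + 1) (fun A _ _ v => ¬ P A v : Pred.{u, v, w} L α) := by
  refine ⟨Empty, inferInstance, _, h.reindex Sum.inl, fun A _ _ v => ?_⟩
  simp only [Sum.elim_comp_inl, exists_const]

theorem succ {k : ℕ} {α : Type} {P : Pred.{u, v, w} L α} (h : SigmaDef k P) :
    SigmaDef (k + 1) P := by
  induction k generalizing α with
  | zero =>
    obtain ⟨φ, hφ, h⟩ := h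
    have : SigmaDef 0 (fun A _ _ v => ¬ P A v : Pred.{u, v, w} L α) :=
      ⟨φ.not, hφ.not, fun A _ _ v => by rw [Formula.realize_not, h]⟩
    exact this.neg.congr fun A _ _ v => not_not.symm
  | succ k ih =>
    obtain ⟨β, hβ, Q, hQ, h⟩ := h
    exact ⟨β, hβ, Q, ih hQ, h⟩

theorem mono {k l : ℕ} (hkl : k ≤ l) {α : Type} {P : Pred.{u, v, w} L α} (h : SigmaDef k P) :
    SigmaDef l P := by
  induction hkl with
  | refl => exact h
  | step _ ih => exact ih.succ

theorem and_or {k : ℕ} {α : Type} {P P' : Pred.{u, v, w} L α} (h : SigmaDef k P)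
    (h' : SigmaDef k P') :
    SigmaDef k (fun A _ _ v => P A v ∧ P' A v : Pred.{u, v, w} L α) ∧
      SigmaDef k (fun A _ _ v => P A v ∨ P' A v : Pred.{u, v, w} L α) := by
  induction k generalizing α with
  | zero =>
    obtain ⟨φ, hφ, h⟩ := h
    obtain ⟨φ', hφ', h'⟩ := h'
    exact ⟨⟨φ ⊓ φ', hφ.inf hφ', fun A _ _ v => by rw [Formula.realize_inf, h, h']⟩,
      ⟨φ ⊔ φ', hφ.sup hφ', fun A _ _ v => by rw [Formula.realize_sup, h, h']⟩⟩
  | succ k ih =>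
    obtain ⟨β, hβ, Q, hQ, h⟩ := h
    obtain ⟨β', hβ', Q', hQ', h'⟩ := h'
    obtain ⟨h1, h2⟩ := ih (hQ.reindex (Sum.map id (Sum.inl : β → β ⊕ β') : α ⊕ β → α ⊕ (β ⊕ β')))
      (hQ'.reindex (Sum.map id (Sum.inr : β' → β ⊕ β') : α ⊕ β' → α ⊕ (β ⊕ β')))
    refine ⟨⟨β ⊕ β', inferInstance, _, h2, fun A _ _ v => ?_⟩,
      ⟨β ⊕ β', inferInstance, _, h1, fun A _ _ v => ?_⟩⟩
    · simp only [h, h', Sum.elim_comp_map, Function.comp_id, not_or]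
      constructor
      · rintro ⟨⟨u, hu⟩, u', hu'⟩
        exact ⟨Sum.elim u u', by rwa [Sum.elim_comp_inl], by rwa [Sum.elim_comp_inr]⟩
      · rintro ⟨u, hu, hu'⟩
        exact ⟨⟨_, hu⟩, _, hu'⟩
    · simp only [h, h', Sum.elim_comp_map, Function.comp_id, not_and_or]
      -- The variables of the other block receive arbitrary values: the structure is nonempty.
      constructor
      · rintro (⟨u, hu⟩ | ⟨u, hu⟩)
        · exact ⟨Sum.elim u fun _ => Classical.arbitrary A, Or.inl (by rwa [Sum.elim_comp_inl])⟩
        · exact ⟨Sum.elim (fun _ => Classical.arbitrary A) u, Or.inr (by rwa [Sum.elim_comp_inr])⟩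
      · rintro ⟨u, hu | hu⟩
        exacts [Or.inl ⟨_, hu⟩, Or.inr ⟨_, hu⟩]

theorem and {k : ℕ} {α : Type} {P P' : Pred.{u, v, w} L α} (h : SigmaDef k P)
    (h' : SigmaDef k P') : SigmaDef k (fun A _ _ v => P A v ∧ P' A v : Pred.{u, v, w} L α) :=
  (h.and_or h').1

theorem or {k : ℕ} {α : Type} {P P' : Pred.{u, v, w} L α} (h : SigmaDef k P)
    (h' : SigmaDef k P') : SigmaDef k (fun A _ _ v => P A v ∨ P' A v : Pred.{u, v, w} L α) :=
  (h.and_or h').2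

/-- Existential quantification over a block of variables. -/
theorem exists_fun {k : ℕ} {α β : Type} [hβ : Finite β]
    {P : ∀ (A : Type w) [L.Structure A] [Nonempty A], (α → A) → (β → A) → Prop}
    (h : SigmaDef (k + 1) (fun A _ _ v => P A (fun i => v (Sum.inl i)) (fun j => v (Sum.inr j)) :
      Pred.{u, v, w} L (α ⊕ β))) :
    SigmaDef (k + 1) (fun A _ _ v => ∃ u : β → A, P A v u : Pred.{u, v, w} L α) := by
  obtain ⟨γ, hγ, Q, hQ, h⟩ := h
  refine ⟨β ⊕ γ, inferInstance, _, hQ.reindex (Equiv.sumAssoc α β γ), fun A _ _ v => ?_⟩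
  have key : ∀ (u : β → A) (u' : γ → A),
      Sum.elim v (Sum.elim u u') ∘ Equiv.sumAssoc α β γ = Sum.elim (Sum.elim v u) u' := by
    intro u u'
    funext i
    rcases i with (i | i) | i <;> rfl
  constructor
  · rintro ⟨u, hu⟩
    obtain ⟨u', hu'⟩ := (h A (Sum.elim v u)).1 hu
    exact ⟨Sum.elim u u', by rwa [key]⟩
  · rintro ⟨u, hu⟩
    refine ⟨fun j => u (Sum.inl j), (h A (Sum.elim v fun j => u (Sum.inl j))).2
      ⟨fun j => u (Sum.inr j), ?_⟩⟩
    rw [← key]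
    convert hu using 4
    funext i
    rcases i with i | i <;> rfl

theorem exists_one {k : ℕ} {α : Type}
    {P : ∀ (A : Type w) [L.Structure A] [Nonempty A], (α → A) → A → Prop}
    (h : SigmaDef (k + 1) (fun A _ _ v => P A (fun i => v (Sum.inl i)) (v (Sum.inr ())) :
      Pred.{u, v, w} L (α ⊕ Unit))) :
    SigmaDef (k + 1) (fun A _ _ v => ∃ x : A, P A v x : Pred.{u, v, w} L α) :=
  (exists_fun (P := fun A _ _ v u => P A v (u ())) h).congr fun _ _ _ _ =>
    ⟨fun ⟨x, hx⟩ => ⟨fun _ => x, hx⟩, fun ⟨u, hu⟩ => ⟨u (), hu⟩⟩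

theorem eq {k : ℕ} {α : Type} (s s' : L.Term α) :
    SigmaDef k (fun _ _ _ v => s.realize v = s'.realize v : Pred.{u, v, w} L α) :=
  mono (Nat.zero_le k) ⟨s.equal s', (BoundedFormula.IsAtomic.equal _ _).isQF, fun A _ _ v => by
    rw [Formula.realize_equal]⟩

theorem ne {k : ℕ} {α : Type} (s s' : L.Term α) :
    SigmaDef k (fun _ _ _ v => ¬ s.realize v = s'.realize v : Pred.{u, v, w} L α) :=
  mono (Nat.zero_le k) ⟨(s.equal s').not, (BoundedFormula.IsAtomic.equal _ _).isQF.not,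
    fun A _ _ v => by rw [Formula.realize_not, Formula.realize_equal]⟩

theorem false (k : ℕ) (α : Type) : SigmaDef k (fun _ _ _ _ => False : Pred.{u, v, w} L α) :=
  mono (Nat.zero_le k) ⟨⊥, BoundedFormula.isQF_bot, fun _ _ _ _ => Iff.rfl⟩

theorem true (k : ℕ) (α : Type) : SigmaDef k (fun _ _ _ _ => True : Pred.{u, v, w} L α) :=
  mono (Nat.zero_le k) ⟨⊤, BoundedFormula.IsQF.top, fun _ _ _ _ => by simp⟩

theorem iOr {k : ℕ} {α : Type} {ι : Type*} [Finite ι] {P : ι → Pred.{u, v, w} L α}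
    (h : ∀ i, SigmaDef k (P i)) :
    SigmaDef k (fun A _ _ v => ∃ i, P i A v : Pred.{u, v, w} L α) := by
  classical
  have := Fintype.ofFinite ι
  have key : ∀ s : Finset ι, SigmaDef k (fun A _ _ v => ∃ i ∈ s, P i A v : Pred.{u, v, w} L α) := by
    intro s
    induction s using Finset.induction_on with
    | empty => exact (false k α).congr fun A _ _ v => by simp
    | insert i s _ ih => exact ((h i).or ih).congr fun A _ _ v => by simp
  exact (key Finset.univ).congr fun A _ _ v => by simp

theorem iAnd {k : ℕ} {α : Type} {ι : Type*} [Finite ι] {P : ι → Pred.{u, v, w} L α}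
    (h : ∀ i, SigmaDef k (P i)) :
    SigmaDef k (fun A _ _ v => ∀ i, P i A v : Pred.{u, v, w} L α) := by
  classical
  have := Fintype.ofFinite ι
  have key : ∀ s : Finset ι, SigmaDef k (fun A _ _ v => ∀ i ∈ s, P i A v : Pred.{u, v, w} L α) := by
    intro s
    induction s using Finset.induction_on with
    | empty => exact (true k α).congr fun A _ _ v => by simp
    | insert i s _ ih => exact ((h i).and ih).congr fun A _ _ v => by simp
  exact (key Finset.univ).congr fun A _ _ v => by simp

theorem exists_isSigma_block {k n : ℕ} (m : ℕ) (ψ : L.BoundedFormula Empty (n + m))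
    (hψ : IsSigma (k + 1) ψ) : ∃ φ : L.BoundedFormula Empty n, IsSigma (k + 1) φ ∧
      ∀ (A : Type w) [L.Structure A] (x : Fin n → A),
        φ.Realize default x ↔ ∃ u : Fin m → A, ψ.Realize default (Fin.append x u) := by
  induction m with
  | zero =>
    exact ⟨ψ, hψ, fun A _ x => by
      rw [Unique.exists_iff, Subsingleton.elim (default : Fin 0 → A) Fin.elim0, Fin.append_elim0]
      rfl⟩
  | succ m ih =>
    obtain ⟨φ, hφ, h⟩ := ih ψ.ex hψ.ex
    refine ⟨φ, hφ, fun A _ x => (h A x).trans ⟨?_, ?_⟩⟩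
    · rintro ⟨u, hu⟩
      obtain ⟨a, ha⟩ := BoundedFormula.realize_ex.1 hu
      exact ⟨Fin.snoc u a, by rwa [Fin.append_snoc]⟩
    · rintro ⟨u, hu⟩
      refine ⟨Fin.init u, BoundedFormula.realize_ex.2 ⟨u (Fin.last m), ?_⟩⟩
      rwa [← Fin.append_snoc, Fin.snoc_init_self]

theorem exists_isPi_block {k n : ℕ} (m : ℕ) (ψ : L.BoundedFormula Empty (n + m))
    (hψ : IsPi (k + 1) ψ) : ∃ φ : L.BoundedFormula Empty n, IsPi (k + 1) φ ∧
      ∀ (A : Type w) [L.Structure A] (x : Fin n → A),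
        φ.Realize default x ↔ ∀ u : Fin m → A, ψ.Realize default (Fin.append x u) := by
  induction m with
  | zero =>
    exact ⟨ψ, hψ, fun A _ x => by
      rw [Unique.forall_iff, Subsingleton.elim (default : Fin 0 → A) Fin.elim0, Fin.append_elim0]
      rfl⟩
  | succ m ih =>
    obtain ⟨φ, hφ, h⟩ := ih ψ.all hψ.all
    refine ⟨φ, hφ, fun A _ x => (h A x).trans ⟨fun hu u => ?_, fun hu u => ?_⟩⟩
    · have := BoundedFormula.realize_all.1 (hu (Fin.init u)) (u (Fin.last m))
      rwa [← Fin.append_snoc, Fin.snoc_init_self] at this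
    · refine BoundedFormula.realize_all.2 fun a => ?_
      rw [← Fin.append_snoc]
      exact hu _

/-- The semantic form of definability agrees with the syntactic one. -/
theorem exists_formula {k : ℕ} {α : Type} {P : Pred.{u, v, w} L α} (h : SigmaDef k P) {n : ℕ}
    (g : α → Fin n) :
    (∃ φ : L.BoundedFormula Empty n, IsSigma k φ ∧
      ∀ (A : Type w) [L.Structure A] [Nonempty A] (x : Fin n → A),
        φ.Realize default x ↔ P A (x ∘ g)) ∧
    (∃ φ : L.BoundedFormula Empty n, IsPi k φ ∧
      ∀ (A : Type w) [L.Structure A] [Nonempty A] (x : Fin n → A),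
        φ.Realize default x ↔ ¬ P A (x ∘ g)) := by
  induction k generalizing α n with
  | zero =>
    obtain ⟨φ, hφ, h⟩ := h
    have key : ∀ (A : Type w) [L.Structure A] [Nonempty A] (x : Fin n → A),
        (BoundedFormula.relabel (fun i => Sum.inr (g i) : α → Empty ⊕ Fin n) φ).Realize default x ↔
          P A (x ∘ g) := by
      intro A _ _ x
      rw [BoundedFormula.realize_relabel, ← h, Formula.Realize,
        Subsingleton.elim (x ∘ Fin.natAdd n : Fin 0 → A) default]
      rfl
    exact ⟨⟨_, .of_isQF (hφ.relabel _), key⟩, ⟨_, .of_isQF (hφ.relabel _).not, fun A _ _ x => by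
      rw [← key]; exact BoundedFormula.realize_not⟩⟩
  | succ k ih =>
    obtain ⟨β, hβ, Q, hQ, h⟩ := h
    let e := Finite.equivFin β
    obtain ⟨⟨φ, hφ, hφQ⟩, ψ, hψ, hψQ⟩ := ih hQ (Sum.elim (fun i => Fin.castAdd _ (g i))
      (fun j => Fin.natAdd n (e j)))
    have key : ∀ {A : Type w} (x : Fin n → A) (u : Fin (Nat.card β) → A),
        Fin.append x u ∘ Sum.elim (fun i => Fin.castAdd _ (g i)) (fun j => Fin.natAdd n (e j)) =
          Sum.elim (x ∘ g) (u ∘ e) := by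
      intro A x u
      funext i
      rcases i with i | j
      · exact Fin.append_left _ _ _
      · exact Fin.append_right _ _ _
    obtain ⟨φ', hφ', h1⟩ := exists_isPi_block.{u, v, w} _ φ (.of_isSigma hφ)
    obtain ⟨ψ', hψ', h2⟩ := exists_isSigma_block.{u, v, w} _ ψ (.of_isPi hψ)
    refine ⟨⟨ψ', hψ', fun A _ _ x => ?_⟩, ⟨φ', hφ', fun A _ _ x => ?_⟩⟩
    · simp only [h2, hψQ, key, h]
      exact ((e.arrowCongr (Equiv.refl A)).symm.surjective.exists (p := fun u =>
        ¬ Q A (Sum.elim (x ∘ g) u))).symm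
    · simp only [h1, hφQ, key, h, not_exists, not_not]
      exact ((e.arrowCongr (Equiv.refl A)).symm.surjective.forall (p := fun u =>
        Q A (Sum.elim (x ∘ g) u))).symm

/-- The predicate itself, rather than a sentence, is defined by a formula with free variables in
`α`; the quantifier prefix is forgotten. -/
theorem exists_openFormula {k : ℕ} {α : Type} [Finite α] {P : Pred.{u, v, w} L α}
    (h : SigmaDef k P) : ∃ χ : L.Formula α,
      ∀ (A : Type w) [L.Structure A] [Nonempty A] (v : α → A), χ.Realize v ↔ P A v := by
  let e := Finite.equivFin α
  obtain ⟨φ, -, hφ⟩ := (h.exists_formula e).1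
  refine ⟨φ.toFormula.relabel (Sum.elim Empty.elim e.symm), fun A _ _ v => ?_⟩
  rw [Formula.realize_relabel, BoundedFormula.realize_toFormula,
    Subsingleton.elim ((v ∘ Sum.elim Empty.elim e.symm) ∘ Sum.inl) default, hφ]
  have : ((v ∘ Sum.elim Empty.elim e.symm) ∘ Sum.inr) ∘ e = v := by
    funext i
    simp
  rw [this]

end SigmaDef

end Definability

/-! ### The sentence -/

section Axiomatization

variable {L : FirstOrder.Language.{u, v}} (t : L.Term (Fin 2)) {N : ℕ} (r r' : Fin N → L.Term Unit)

theorem sigmaDef_mul_eq {k : ℕ} {α : Type} (x y z : α) :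
    SigmaDef k (fun _ _ _ v => mul t (v x) (v y) = v z : Pred.{u, v, w} L α) := by
  refine (SigmaDef.eq (t.relabel ![x, y]) (Term.var z)).congr fun A _ _ v => ?_
  have : v ∘ ![x, y] = ![v x, v y] := by
    funext i
    fin_cases i <;> rfl
  rw [Term.realize_relabel, this]
  rfl

theorem sigmaDef_square {α : Type} (q p s e : α) :
    SigmaDef 2 (fun _ _ _ v => Square t (v q) (v p) (v s) (v e) : Pred.{u, v, w} L α) := by
  have hlub : SigmaDef 1 (fun A _ _ v => ∃ x, mul t (v p) x = v p ∧ mul t (v s) x = v s ∧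
      ¬ mul t (v e) x = v e : Pred.{u, v, w} L α) := by
    refine SigmaDef.exists_one ((sigmaDef_mul_eq t (Sum.inl p) (Sum.inr ()) (Sum.inl p)).and
      ((sigmaDef_mul_eq t (Sum.inl s) (Sum.inr ()) (Sum.inl s)).and ?_))
    exact (sigmaDef_mul_eq t (k := 0) (Sum.inl e) (Sum.inr ()) (Sum.inl e)).neg
  refine ((sigmaDef_mul_eq t p e p).and ((sigmaDef_mul_eq t s e s).and
    ((sigmaDef_mul_eq t p s q).and hlub.neg))).congr fun A _ _ v => ?_
  simp only [Square, not_exists, not_and, not_not]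

theorem sigmaDef_base {k : ℕ} {α : Type} (w : α) (m m' : Fin N → α) (x y : α) :
    SigmaDef k (fun _ _ _ v => base r r' (v w) (fun i => v (m i)) (fun i => v (m' i)) (v x) (v y) :
      Pred.{u, v, w} L α) := by
  refine SigmaDef.iOr fun i => SigmaDef.or (SigmaDef.and ?_ ?_) (SigmaDef.and ?_ ?_)
  · exact (SigmaDef.eq (Term.var x) ((r i).relabel fun _ => w)).congr fun A _ _ v => by
      rw [Term.realize_relabel]; rfl
  · exact SigmaDef.eq (Term.var y) (Term.var (m i))
  · exact SigmaDef.eq (Term.var x) (Term.var (m' i))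
  · exact (SigmaDef.eq (Term.var y) ((r' i).relabel fun _ => w)).congr fun A _ _ v => by
      rw [Term.realize_relabel]; rfl

/-- Each stage of the generation is `Σ_2`, since being a least upper bound is `Π_1`. -/
theorem sigmaDef_stage [Finite L.Symbols] (n : ℕ) {α : Type} (w : α) (m m' : Fin N → α) (x y : α) :
    SigmaDef 2 (fun _ _ _ v => Stage t
      (base r r' (v w) (fun i => v (m i)) (fun i => v (m' i))) n (v x) (v y) :
      Pred.{u, v, w} L α) := by
  have : Finite (Σ n, L.Functions n) := Finite.of_injective (Sum.inl : _ → L.Symbols)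
    Sum.inl_injective
  induction n generalizing α with
  | zero => exact (SigmaDef.eq (Term.var x) (Term.var y)).or (sigmaDef_base r r' w m m' x y)
  | succ n ih =>
    refine (ih w m m' x y).or ((ih w m m' y x).or (SigmaDef.or ?_ (SigmaDef.or ?_
      (SigmaDef.or ?_ ?_))))
    · exact SigmaDef.exists_one
        ((ih (Sum.inl w) (fun i => Sum.inl (m i)) (fun i => Sum.inl (m' i)) (Sum.inl x)
          (Sum.inr ())).and
        (ih (Sum.inl w) (fun i => Sum.inl (m i)) (fun i => Sum.inl (m' i)) (Sum.inr ())
          (Sum.inl y)))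
    · refine SigmaDef.iOr fun F => SigmaDef.exists_fun (SigmaDef.exists_fun
        (SigmaDef.and (SigmaDef.iAnd fun i => ?_) (SigmaDef.and ?_ ?_)))
      · exact ih (Sum.inl (Sum.inl w)) (fun i => Sum.inl (Sum.inl (m i)))
          (fun i => Sum.inl (Sum.inl (m' i))) (Sum.inl (Sum.inr i)) (Sum.inr i)
      · exact SigmaDef.eq (Term.func F.2 fun i => Term.var (Sum.inl (Sum.inr i)))
          (Term.var (Sum.inl (Sum.inl x)))
      · exact SigmaDef.eq (Term.func F.2 fun i => Term.var (Sum.inr i))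
          (Term.var (Sum.inl (Sum.inl y)))
    · exact SigmaDef.exists_one (SigmaDef.exists_one
        ((ih (Sum.inl (Sum.inl w)) (fun i => Sum.inl (Sum.inl (m i)))
          (fun i => Sum.inl (Sum.inl (m' i))) (Sum.inl (Sum.inr ())) (Sum.inr ())).and
        (sigmaDef_square t (Sum.inl (Sum.inl x)) (Sum.inl (Sum.inl y)) (Sum.inl (Sum.inr ()))
          (Sum.inr ()))))
    · exact SigmaDef.exists_one (SigmaDef.exists_one
        ((ih (Sum.inl (Sum.inl w)) (fun i => Sum.inl (Sum.inl (m i)))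
          (fun i => Sum.inl (Sum.inl (m' i))) (Sum.inl (Sum.inr ())) (Sum.inr ())).and
        (sigmaDef_square t (Sum.inl (Sum.inr ())) (Sum.inr ()) (Sum.inl (Sum.inl x))
          (Sum.inl (Sum.inl y)))))

/-- The parameters `w`, `m`, `m'` encode a nontrivial decomposition: the `n`-th stages generated
by them are a pair of nontrivial complementary factor congruences. That stage `n` is a
congruence is expressed by its containing stage `n + 1`. -/
structure IsCode (n : ℕ) {A : Type w} [L.Structure A] (w : A) (m m' : Fin N → A) : Prop where
  th_closed : ∀ x y, Stage t (base r r' w m m') (n + 1) x y → Stage t (base r r' w m m') n x y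
  de_closed : ∀ x y, Stage t (base r r' w m' m) (n + 1) x y → Stage t (base r r' w m' m) n x y
  inter : ∀ x y, Stage t (base r r' w m m') n x y → Stage t (base r r' w m' m) n x y → x = y
  comp : ∀ x y, ∃ z, Stage t (base r r' w m m') n x z ∧ Stage t (base r r' w m' m) n z y
  th_nontrivial : ∃ x y, Stage t (base r r' w m m') n x y ∧ ¬ x = y
  de_nontrivial : ∃ x y, Stage t (base r r' w m' m) n x y ∧ ¬ x = y

theorem sigmaDef_isCode [Finite L.Symbols] (n : ℕ) {α : Type} (w : α) (m m' : Fin N → α) :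
    SigmaDef 4 (fun _ _ _ v => IsCode t r r' n (v w) (fun i => v (m i)) (fun i => v (m' i)) :
      Pred.{u, v, w} L α) := by
  have hst : ∀ (k : ℕ) (m m' : Fin N → α) (β : Type) (x y : α ⊕ β),
      SigmaDef 2 (fun A _ _ v => Stage t (base r r' (v (Sum.inl w)) (fun i => v (Sum.inl (m i)))
        (fun i => v (Sum.inl (m' i)))) k (v x) (v y) : Pred.{u, v, w} L (α ⊕ β)) :=
    fun k m m' β x y => sigmaDef_stage t r r' k _ _ _ x y
  have hst' : ∀ (k : ℕ) (m m' : Fin N → α) (β γ : Type) (x y : (α ⊕ β) ⊕ γ),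
      SigmaDef 2 (fun A _ _ v => Stage t (base r r' (v (Sum.inl (Sum.inl w)))
        (fun i => v (Sum.inl (Sum.inl (m i))))
        (fun i => v (Sum.inl (Sum.inl (m' i))))) k (v x) (v y) : Pred.{u, v, w} L ((α ⊕ β) ⊕ γ)) :=
    fun k m m' β γ x y => sigmaDef_stage t r r' k _ _ _ x y
  have hclosed : ∀ m m' : Fin N → α, SigmaDef 3 (fun A _ _ v => ∃ x y,
      Stage t (base r r' (v w) (fun i => v (m i)) (fun i => v (m' i))) (n + 1) x y ∧
      ¬ Stage t (base r r' (v w) (fun i => v (m i)) (fun i => v (m' i))) n x y :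
      Pred.{u, v, w} L α) := fun m m' =>
    SigmaDef.exists_one (SigmaDef.exists_one ((hst' _ m m' _ _ (Sum.inl (Sum.inr ()))
      (Sum.inr ())).succ.and (hst' _ m m' _ _ (Sum.inl (Sum.inr ())) (Sum.inr ())).neg))
  have hinter : SigmaDef 3 (fun A _ _ v => ∃ x y,
      Stage t (base r r' (v w) (fun i => v (m i)) (fun i => v (m' i))) n x y ∧
      Stage t (base r r' (v w) (fun i => v (m' i)) (fun i => v (m i))) n x y ∧ ¬ x = y :
      Pred.{u, v, w} L α) :=
    SigmaDef.exists_one (SigmaDef.exists_one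
      ((hst' _ m m' _ _ (Sum.inl (Sum.inr ())) (Sum.inr ())).succ.and
      ((hst' _ m' m _ _ (Sum.inl (Sum.inr ())) (Sum.inr ())).succ.and
      (SigmaDef.ne (Term.var (Sum.inl (Sum.inr ()))) (Term.var (Sum.inr ()))))))
  have hcomp : SigmaDef 3 (fun A _ _ v => ∃ x y, ¬ ∃ z,
      Stage t (base r r' (v w) (fun i => v (m i)) (fun i => v (m' i))) n x z ∧
      Stage t (base r r' (v w) (fun i => v (m' i)) (fun i => v (m i))) n z y :
      Pred.{u, v, w} L α) := by
    refine SigmaDef.exists_one (SigmaDef.exists_one (SigmaDef.neg (SigmaDef.exists_one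
      (SigmaDef.and ?_ ?_))))
    · exact sigmaDef_stage t r r' n (Sum.inl (Sum.inl (Sum.inl w)))
        (fun i => Sum.inl (Sum.inl (Sum.inl (m i)))) (fun i => Sum.inl (Sum.inl (Sum.inl (m' i))))
        (Sum.inl (Sum.inl (Sum.inr ()))) (Sum.inr ())
    · exact sigmaDef_stage t r r' n (Sum.inl (Sum.inl (Sum.inl w)))
        (fun i => Sum.inl (Sum.inl (Sum.inl (m' i)))) (fun i => Sum.inl (Sum.inl (Sum.inl (m i))))
        (Sum.inr ()) (Sum.inl (Sum.inr ()))
  have hnt : ∀ m m' : Fin N → α, SigmaDef 2 (fun A _ _ v => ∃ x y,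
      Stage t (base r r' (v w) (fun i => v (m i)) (fun i => v (m' i))) n x y ∧ ¬ x = y :
      Pred.{u, v, w} L α) := fun m m' =>
    SigmaDef.exists_one (SigmaDef.exists_one
      ((hst' _ m m' _ _ (Sum.inl (Sum.inr ())) (Sum.inr ())).and
      (SigmaDef.ne (Term.var (Sum.inl (Sum.inr ()))) (Term.var (Sum.inr ())))))
  refine ((hclosed m m').or ((hclosed m' m).or (hinter.or (hcomp.or
    ((hnt m m').neg.or (hnt m' m).neg))))).neg.congr fun A _ _ v => ?_
  constructor
  · rintro ⟨h1, h2, h3, h4, h5, h6⟩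
    rintro (⟨x, y, h, h'⟩ | ⟨x, y, h, h'⟩ | ⟨x, y, h, h', hne⟩ | ⟨x, y, h⟩ | h | h)
    exacts [h' (h1 x y h), h' (h2 x y h), hne (h3 x y h h'), h (h4 x y), h h5, h h6]
  · intro h
    simp only [not_or, not_not] at h
    obtain ⟨h1, h2, h3, h4, h5, h6⟩ := h
    exact ⟨fun x y hxy => by_contra fun hn => h1 ⟨x, y, hxy, hn⟩,
      fun x y hxy => by_contra fun hn => h2 ⟨x, y, hxy, hn⟩,
      fun x y hxy hxy' => by_contra fun hn => h3 ⟨x, y, hxy, hxy', hn⟩,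
      fun x y => by_contra fun hn => h4 ⟨x, y, hn⟩, h5, h6⟩

variable {t r r'}

theorem stage_isCongruence {A : Type w} [L.Structure A] {R : A → A → Prop} {n : ℕ}
    (h : ∀ x y, Stage t R (n + 1) x y → Stage t R n x y) :
    Equivalence (Stage t R n) ∧ Compatible L (Stage t R n) :=
  ⟨⟨fun _ => Stage.mono (Nat.zero_le n) (Or.inl rfl), fun hxy => h _ _ (Or.inr (Or.inl hxy)),
    fun h1 h2 => h _ _ (Or.inr (Or.inr (Or.inl ⟨_, h1, h2⟩)))⟩,
    fun F x y hxy => h _ _ (Or.inr (Or.inr (Or.inr (Or.inl ⟨F, x, y, hxy, rfl, rfl⟩))))⟩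

/-- An algebra with a pair of nontrivial complementary factor congruences is isomorphic to the
product of its quotients by them. -/
theorem IsCode.not_directlyIndecomposable [L.IsAlgebraic] {n : ℕ} {A : Type w} [L.Structure A]
    {w : A} {m m' : Fin N → A} (h : IsCode t r r' n w m m') : ¬ DirectlyIndecomposable L A := by
  intro hA
  obtain ⟨e1, c1⟩ := stage_isCongruence h.th_closed
  obtain ⟨e2, c2⟩ := stage_isCongruence h.de_closed
  let s1 : Setoid A := ⟨_, e1⟩
  let s2 : Setoid A := ⟨_, e2⟩
  let _ : L.Prestructure s1 := quotientPrestructure s1 c1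
  let _ : L.Prestructure s2 := quotientPrestructure s2 c2
  let g : A → Quotient s1 × Quotient s2 := fun x => (Quotient.mk s1 x, Quotient.mk s2 x)
  have hg : Function.Bijective g := by
    refine ⟨fun x y hxy => ?_, fun ⟨x, y⟩ => ?_⟩
    · obtain ⟨h1, h2⟩ := Prod.ext_iff.1 hxy
      exact h.inter x y (Quotient.exact h1) (Quotient.exact h2)
    · induction x using Quotient.inductionOn with | _ x
      induction y using Quotient.inductionOn with | _ y
      obtain ⟨z, h1, h2⟩ := h.comp x y
      exact ⟨z, Prod.ext (Quotient.sound (e1.symm h1)) (Quotient.sound h2)⟩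
  let e : A ≃[L] Quotient s1 × Quotient s2 :=
    { Equiv.ofBijective g hg with
      map_fun' := fun {k} F x => Prod.ext (funMap_quotient_mk' s1 F x).symm
        (funMap_quotient_mk' s2 F x).symm
      map_rel' := fun {k} R => isEmptyElim R }
  rcases hA.2 _ _ ⟨e⟩ with hs | hs
  · obtain ⟨x, y, hxy, hne⟩ := h.de_nontrivial
    exact hne (h.inter x y (Quotient.exact (hs.elim _ _)) hxy)
  · obtain ⟨x, y, hxy, hne⟩ := h.th_nontrivial
    exact hne (h.inter x y hxy (Quotient.exact (hs.elim _ _)))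

/-- The decomposition operation of a direct product, transported along an isomorphism. -/
theorem isDecomposition_of_equiv {A B C : Type w} [L.Structure A] [L.Structure B] [L.Structure C]
    (e : A ≃[L] B × C) : IsDecomposition L fun x y => e.symm ((e x).1, (e y).2) := by
  refine ⟨fun x => ?_, fun x y z => ?_, fun x y z => ?_, fun F x y => ?_⟩
  · exact e.symm_apply_apply x
  · simp only [e.apply_symm_apply]
  · simp only [e.apply_symm_apply]
  · rw [e.map_fun, e.map_fun]
    exact e.symm.map_fun F fun i => ((e (x i)).1, (e (y i)).2)

/-- Every nontrivial decomposition is encoded by the mixtures of the values of the unary terms at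
an arbitrary element `w`. The assumption `hn` is applied to `f` and to its flip, which exchanges
the two kernels and the two families of mixtures. -/
theorem IsDecomposition.isCode {A : Type w} [L.Structure A] (hA : IsRelativeSemilattice t A)
    {f : A → A → A} (hf : IsDecomposition L f) {n : ℕ} (w : A)
    (hn : ∀ f : A → A → A, IsDecomposition L f → ∀ x y, f x y = y →
      Stage t (base r r' w (mixtures r r' f w) (mixtures r' r f w)) n x y)
    (hfst : ∃ x y, f x y = y ∧ ¬ x = y) (hsnd : ∃ x y, f y x = y ∧ ¬ x = y) :
    IsCode t r r' n w (mixtures r r' f w) (mixtures r' r f w) := by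
  have hTh : ∀ {k x y}, Stage t (base r r' w (mixtures r r' f w) (mixtures r' r f w)) k x y →
      f x y = y := fun h => hf.stage_sound hA h
  have hDe : ∀ {k x y}, Stage t (base r r' w (mixtures r' r f w) (mixtures r r' f w)) k x y →
      f y x = y := fun h => hf.flip.stage_sound hA h
  have hTh' := hn f hf
  have hDe' : ∀ x y, f y x = y →
      Stage t (base r r' w (mixtures r' r f w) (mixtures r r' f w)) n x y := hn _ hf.flip
  refine ⟨fun x y h => hTh' _ _ (hTh h), fun x y h => hDe' _ _ (hDe h), fun x y h1 h2 => ?_,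
    fun x y => ⟨f x y, hTh' _ _ (hf.right _ _ _), hDe' _ _ ?_⟩, ?_, ?_⟩
  · rw [← hTh h1, ← hDe h2, hf.right, hf.self]
  · rw [hf.right, hf.self]
  · obtain ⟨x, y, h, hne⟩ := hfst
    exact ⟨x, y, hTh' _ _ h, hne⟩
  · obtain ⟨x, y, h, hne⟩ := hsnd
    exact ⟨x, y, hDe' _ _ h, hne⟩

end Axiomatization

end PoGroupoid

open PoGroupoid FirstOrder.Language in
theorem theorem2 (L : FirstOrder.Language.{u, v}) [L.IsAlgebraic] [Finite L.Symbols]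
    (E : Set (PoGroupoid.Identity L)) (t : L.Term (Fin 2))
    (_ : ∀ (A : Type w) [L.Structure A] [Nonempty A], A ⊨ PoGroupoid.axiomsOf E →
      PoGroupoid.IsPoGroupoid t A)
    (hconn : ∀ (A : Type w) [L.Structure A] [Nonempty A], A ⊨ PoGroupoid.axiomsOf E →
      PoGroupoid.IsConnected t A)
    (hsemi : PoGroupoid.Semidegenerate.{u, v, w} E)
    (hrel : ∀ (A : Type w) [L.Structure A] [Nonempty A], A ⊨ PoGroupoid.axiomsOf E →
      PoGroupoid.IsRelativeSemilattice t A) :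
    ∃ φ : L.Sentence, PoGroupoid.IsPi 4 φ ∧
      ∀ (A : Type w) [L.Structure A] [Nonempty A],
        A ⊨ PoGroupoid.axiomsOf E ∪ {φ} ↔
          A ⊨ PoGroupoid.axiomsOf E ∧ PoGroupoid.DirectlyIndecomposable L A := by
  obtain ⟨ℓ, p, hp⟩ := exists_isPath t hconn
  obtain ⟨N, r, r', hr⟩ := exists_isSplittingFamily ℓ p
  obtain ⟨n, hn⟩ := exists_uniform_stage (t := t) hr
    (fun A _ _ hA => ⟨hrel A hA, hp A hA, hsemi.noProperSubalgebraClass hA⟩) fun n =>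
      (sigmaDef_stage t r r' n (Sum.inl 0) (fun i => Sum.inr (Sum.inl i))
        (fun i => Sum.inr (Sum.inr i)) (Sum.inl 1) (Sum.inl 2)).exists_openFormula
  have hcode : SigmaDef 4 (fun A _ _ _ => (∃ c : Unit ⊕ Fin N ⊕ Fin N → A,
      IsCode t r r' n (c (Sum.inl ())) (fun i => c (Sum.inr (Sum.inl i)))
        (fun i => c (Sum.inr (Sum.inr i)))) ∨ ¬ ∃ x y : A, ¬ x = y : Pred.{u, v, w} L Empty) := by
    refine (SigmaDef.exists_fun (sigmaDef_isCode t r r' n (Sum.inr (Sum.inl ()))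
      (fun i => Sum.inr (Sum.inr (Sum.inl i))) (fun i => Sum.inr (Sum.inr (Sum.inr i))))).or ?_
    exact (SigmaDef.exists_one (k := 2) (SigmaDef.exists_one (SigmaDef.ne
      (Term.var (Sum.inl (Sum.inr ()))) (Term.var (Sum.inr ()))))).neg
  obtain ⟨φ, hφ, hφA⟩ := (hcode.exists_formula (n := 0) (fun i => i.elim)).2
  refine ⟨φ, hφ, fun A _ _ => ?_⟩
  have hmodel : A ⊨ axiomsOf E ∪ {φ} ↔ A ⊨ axiomsOf E ∧ A ⊨ φ := by
    simp only [Theory.model_iff, Set.mem_union, Set.mem_singleton_iff, or_imp, forall_and,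
      forall_eq]
  rw [hmodel]
  refine and_congr_right fun hA => ?_
  refine (Iff.trans (by rfl) (hφA A default)).trans ?_
  rw [not_or, not_not]
  constructor
  · rintro ⟨h1, x, y, hxy⟩
    refine ⟨⟨x, y, hxy⟩, fun B C _ _ ⟨e⟩ => ?_⟩
    by_contra! hBC
    obtain ⟨⟨b, b', hb⟩, c, c', hc⟩ := hBC
    have hf := isDecomposition_of_equiv e
    refine h1 ⟨Sum.elim (fun _ => x) (Sum.elim
      (mixtures r r' (fun x y => e.symm ((e x).1, (e y).2)) x)
      (mixtures r' r (fun x y => e.symm ((e x).1, (e y).2)) x)),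
      hf.isCode (hrel A hA) x (fun f hf => hn A hA f hf x)
      ⟨e.symm (b, c), e.symm (b, c'), ?_, fun h => hc ?_⟩
      ⟨e.symm (b, c), e.symm (b', c), ?_, fun h => hb ?_⟩⟩
    · simp only [e.apply_symm_apply]
    · exact congrArg Prod.snd (e.symm.injective h)
    · simp only [e.apply_symm_apply]
    · exact congrArg Prod.fst (e.symm.injective h)
  · rintro h
    refine ⟨fun ⟨c, hc⟩ => hc.not_directlyIndecomposable h, ?_⟩
    obtain ⟨x, y, hxy⟩ := h.1
    exact ⟨x, y, hxy⟩
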